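/- **Proposition 2.7.** Let $0<\alpha<1$ and let $E_1,E_2,\dots$ (the energy landscape) be independent exponential random variables with parameter $\alpha$; put $x_i=e^{-E_i}$. Given the landscape and $N\ge 1$, let $Y_N$ be the continuous-time random walk on $\{1,\dots,N\}$ that jumps from $i$ to each $j\neq i$ at rate $x_i/N$ and whose initial distribution is uniform. Let $\mathbb P_N$ be its law, and put $x_N(s)=x_k$ if $Y_N(s)=k$. For $0<\delta\le 1$ let $$B(\delta)=\frac{\int_\delta^1 x^{\alpha-2}\,dx}{\int_0^\infty \frac{x^{\alpha-1}}{1+x}\,dx},\qquad c(\alpha)=\int_0^\infty y^{\alpha-1}e^{-y}\,dy=\Gamma(\alpha).$$ Then for almost every landscape the following holds for every $\delta\in(0,1]$: the limit $\lim_{N\to\infty}\mathbb P_N(x_N(s)>\delta)$ exists for every $s>0$, and $$\lim_{s\to\infty}s^{1-\alpha}\lim_{N\to\infty}\mathbb P_N\bigl(x_N(s)>\delta\bigr)=\frac{B(\delta)}{c(\alpha)}.$$ -/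

import Mathlib

open MeasureTheory ProbabilityTheory Filter Topology Set
open scoped NNReal

/-- A continuous-time random walk `Y` on a finite set `S`, defined on a probability space
`(Ω', P)`, with initial distribution `ν` and transition rates `c i j` (`i ≠ j`):
a right-continuous process with the Markov property such that
`P (Y (t + h) = j | Y t = i) = c i j * h + o(h)` as `h ↓ 0`, uniformly in `t`, for `i ≠ j`
(the values `c i i` play no role).
Both conditional statements are multiplied out, so that they are void where
the conditioning event is null. -/
structure IsRandomWalkWithRates {S Ω' : Type*} [Fintype S] [MeasurableSpace S] [MeasurableSingletonClass S]
    [MeasurableSpace Ω'] (c : S → S → ℝ) (ν : Measure S)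
    (P : Measure Ω') (Y : ℝ≥0 → Ω' → S) : Prop where
  isProbabilityMeasure : IsProbabilityMeasure P
  measurable : ∀ t, Measurable (Y t)
  /-- the initial distribution is `ν` -/
  initial : P.map (Y 0) = ν
  /-- almost surely the path stays for a positive time in each state that it takes -/
  rightContinuous : ∀ᵐ w ∂P, ∀ t, ∀ᶠ u in 𝓝[≥] t, Y u w = Y t w
  /-- given `Y t = i`, the state `Y (t + h)` is independent of the states at times `r m ≤ t` -/
  markov : ∀ (n : ℕ) (r : Fin n → ℝ≥0) (k : Fin n → S) (t h : ℝ≥0) (i j : S),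
    (∀ m, r m ≤ t) →
      P.real {w | (∀ m, Y (r m) w = k m) ∧ Y t w = i ∧ Y (t + h) w = j} *
          P.real {w | Y t w = i} =
        P.real {w | (∀ m, Y (r m) w = k m) ∧ Y t w = i} *
          P.real {w | Y t w = i ∧ Y (t + h) w = j}
  /-- `P (Y (t + h) = j | Y t = i) = c i j * h + o(h)` for `i ≠ j`, uniformly in `t` -/
  rates : ∀ i j, i ≠ j → ∀ ε : ℝ, 0 < ε → ∃ η : ℝ≥0, 0 < η ∧
    ∀ h : ℝ≥0, 0 < h → h < η → ∀ t : ℝ≥0,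
      |P.real {w | Y t w = i ∧ Y (t + h) w = j} - c i j * h * P.real {w | Y t w = i}|
        ≤ ε * h * P.real {w | Y t w = i}

namespace TrapModel

/-- The variable `x i = exp (-E i)`, the inverse of the waiting time `exp (E i)`,
for an energy landscape `e`. -/
noncomputable def invWait (e : ℕ → ℝ) (i : ℕ) : ℝ := Real.exp (-e i)

/-- `Y` is, given the energy landscape `e`, the random walk of the REM-like trap model on the
complete graph with `N` sites: the transition rates are `exp (-e i) / N` for `i ≠ j`, and the
initial distribution is uniform. The sites are `0, …, N - 1`. -/
def IsREMTrapWalk (e : ℕ → ℝ) (N : ℕ) {Ω' : Type*} [MeasurableSpace Ω']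
    (P : Measure Ω') (Y : ℝ≥0 → Ω' → Fin N) : Prop :=
  IsRandomWalkWithRates (fun i _ : Fin N => invWait e i / N) (uniformOn univ) P Y

/-- The constant `B(δ)`. -/
noncomputable def B (α δ : ℝ) : ℝ :=
  (∫ x in δ..1, x ^ (α - 2)) / ∫ x in Ioi (0 : ℝ), x ^ (α - 1) / (1 + x)

/-- The constant `c(α)`, that is, `Γ(α)`. -/
noncomputable def c (α : ℝ) : ℝ :=
  ∫ y in Ioi (0 : ℝ), y ^ (α - 1) * Real.exp (-y)

end TrapModel

/-!
Fix the landscape and write `p i t` for the probability that the walk on `n` sites is in `i` at time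
`t`, and `ψ t = ∑ x i * p i t` for its expected jump rate. Every jump leads to a uniformly
distributed site (jumps to the present site may be added at will), so conditioning on the last jump
gives, for every `g`,
`∑ g i * p i = A_g + A_g ∗ ψ`, where `A_g t = n⁻¹ * ∑ g i * exp (-x i * t)`
(`IsTrapFlow.sum_mul_eq`). With `g = x` this is a renewal equation for `ψ`, with `g = 1` it is
`1 = G + G ∗ ψ`, and with the indicator of `x i > δ` it is the probability in question.

For almost every landscape the empirical averages `A_g` converge (`ae_isTypical`), hence so do the
solutions `ψ` of the renewal equations, and all these identities pass to the limit
(`exists_limit_rate`). It remains to find the behaviour at infinity of the limiting `ψ`, the renewal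
density for a waiting time with tail `G t = E[exp (-x t)] ∼ α Γ(α) t ^ (-α)`, of infinite mean.

A strong renewal theorem is available for every `α` because `ψ` is antitone. For finitely many sites
this follows from reversibility: `ψ t = n * ∑ x i * p i (t / 2) ^ 2`, and the right-hand side
decreases by the Cauchy-Schwarz inequality (`IsTrapFlow.antitoneOn_jumpRate`). Convolving
`1 = G + G ∗ ψ` with `t ^ (α - 1)` yields `K ∗ ψ = t ^ α / α - K`, where `K = t ^ (α - 1) ∗ G`
increases to a constant `κ` by scaling (`tendsto_smoothTail`). So the integral of `ψ` over `[0, t]`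
is asymptotic to `t ^ α / (α κ)`, and monotonicity gives `t ^ (1 - α) * ψ t → 1 / κ`
(`tendsto_rate`). Finally the probability of `x > δ` is `A + A ∗ ψ` with `A` exponentially small, so
that it is asymptotic to `ψ * ∫ A` (`tendsto_rpow_mul_conv`); here `∫ A = E[1 / x; x > δ]`
(`integral_meanTail`).
-/

namespace TrapModel

/-! ### The forward equation of a random walk -/

section Forward

variable {S Ω' : Type*} [MeasurableSpace Ω'] {P : Measure Ω'} {Y : ℝ≥0 → Ω' → S}

/-- The probability that the walk is in `j` at time `t`, as a function of a real time; it is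
extended to `t < 0` by its value at time `0`. -/
noncomputable def occ (P : Measure Ω') (Y : ℝ≥0 → Ω' → S) (j : S) (t : ℝ) : ℝ :=
  P.real {w | Y t.toNNReal w = j}

/-- The net rate at which probability flows into `j` under the transition rates `c`, when `p` is
the current distribution. The term `i = j` vanishes, whatever `c j j` is. -/
def netRate [Fintype S] (c : S → S → ℝ) (p : S → ℝ) (j : S) : ℝ :=
  ∑ i, (c i j * p i - c j i * p j)

lemma occ_nonneg (j : S) (t : ℝ) : 0 ≤ occ P Y j t := measureReal_nonneg

variable [Fintype S] [MeasurableSpace S] [MeasurableSingletonClass S] {c : S → S → ℝ}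
  {ν : Measure S}

lemma measureReal_eq_sum_inter [IsFiniteMeasure P] {f : Ω' → S} (hf : Measurable f)
    {A : Set Ω'} : P.real A = ∑ i, P.real {w | f w = i ∧ w ∈ A} := by
  have h := measureReal_biUnion_finset (μ := P.restrict A) (s := Finset.univ)
    (f := fun i => f ⁻¹' {i})
    (fun i _ j _ hij => Disjoint.preimage f (by simpa using hij))
    (fun i _ => hf (measurableSet_singleton i))
  have hu : (⋃ i ∈ (Finset.univ : Finset S), f ⁻¹' {i}) = univ := by ext; simp
  rw [hu, measureReal_restrict_apply MeasurableSet.univ, univ_inter] at h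
  rw [h]
  refine Finset.sum_congr rfl fun i _ => ?_
  rw [measureReal_restrict_apply (hf (measurableSet_singleton i))]
  rfl

lemma sum_occ (hY : IsRandomWalkWithRates c ν P Y) (t : ℝ) : ∑ j, occ P Y j t = 1 := by
  have := hY.isProbabilityMeasure
  have h := measureReal_eq_sum_inter (P := P) (hY.measurable t.toNNReal) (A := univ)
  simpa [occ] using h.symm

lemma occ_le_one (hY : IsRandomWalkWithRates c ν P Y) (j : S) (t : ℝ) : occ P Y j t ≤ 1 := by
  have := hY.isProbabilityMeasure
  exact measureReal_le_one

/-- The increments of the occupation probabilities are, to first order and uniformly in time,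
given by the net rates. -/
lemma eventually_increment (hY : IsRandomWalkWithRates c ν P Y) (j : S) {ε : ℝ} (hε : 0 < ε) :
    ∀ᶠ h : ℝ in 𝓝[>] 0, ∀ t : ℝ, 0 ≤ t →
      |occ P Y j (t + h) - occ P Y j t - h * netRate c (fun i => occ P Y i t) j| ≤ ε * h := by
  classical
  have := hY.isProbabilityMeasure
  have hcard : (0 : ℝ) < 2 * Fintype.card S := by
    have : Nonempty S := ⟨j⟩
    have : (0 : ℝ) < Fintype.card S := by exact_mod_cast Fintype.card_pos
    positivity
  set ε' := ε / (2 * Fintype.card S) with hε'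
  have hε'0 : 0 < ε' := by positivity
  have key : ∀ a b : S, a ≠ b → ∀ᶠ h : ℝ in 𝓝[>] 0, ∀ t : ℝ, 0 ≤ t →
      |P.real {w | Y t.toNNReal w = a ∧ Y (t + h).toNNReal w = b} - c a b * h * occ P Y a t|
        ≤ ε' * h := by
    intro a b hab
    obtain ⟨η, hη, H⟩ := hY.rates a b hab ε' hε'0
    have : ∀ᶠ h : ℝ in 𝓝[>] 0, h ∈ Ioo 0 (η : ℝ) := Ioo_mem_nhdsGT (by exact_mod_cast hη)
    filter_upwards [this] with h hh t ht
    have h1 := H h.toNNReal (by simpa using hh.1) (by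
      rw [← NNReal.coe_lt_coe, Real.coe_toNNReal _ hh.1.le]; exact hh.2) t.toNNReal
    rw [← Real.toNNReal_add ht hh.1.le, Real.coe_toNNReal _ hh.1.le] at h1
    refine h1.trans ?_
    have : ε' * h * P.real {w | Y t.toNNReal w = a} ≤ ε' * h * 1 := by
      have : 0 ≤ ε' * h := mul_nonneg hε'0.le hh.1.le
      gcongr
      exact measureReal_le_one
    simpa using this
  have key2 : ∀ᶠ h : ℝ in 𝓝[>] 0, ∀ i, i ≠ j → (∀ t : ℝ, 0 ≤ t →
      |P.real {w | Y t.toNNReal w = i ∧ Y (t + h).toNNReal w = j} - c i j * h * occ P Y i t|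
        ≤ ε' * h) ∧ ∀ t : ℝ, 0 ≤ t →
      |P.real {w | Y t.toNNReal w = j ∧ Y (t + h).toNNReal w = i} - c j i * h * occ P Y j t|
        ≤ ε' * h := by
    rw [eventually_all]
    intro i
    by_cases hij : i = j
    · simp [hij]
    · filter_upwards [key i j hij, key j i (Ne.symm hij)] with h h1 h2 _
      exact ⟨h1, h2⟩
  filter_upwards [key2, self_mem_nhdsWithin] with h hh hpos t ht
  have e1 : occ P Y j (t + h)
      = ∑ i, P.real {w | Y t.toNNReal w = i ∧ Y (t + h).toNNReal w = j} :=
    measureReal_eq_sum_inter (hY.measurable _)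
  have e2 : occ P Y j t
      = ∑ i, P.real {w | Y t.toNNReal w = j ∧ Y (t + h).toNNReal w = i} := by
    rw [occ, measureReal_eq_sum_inter (P := P) (hY.measurable (t + h).toNNReal)]
    refine Finset.sum_congr rfl fun i _ => ?_
    congr 1; ext w; exact and_comm
  rw [netRate, Finset.mul_sum, e1]
  nth_rewrite 1 [e2]
  rw [← Finset.sum_sub_distrib, ← Finset.sum_sub_distrib]
  refine (Finset.abs_sum_le_sum_abs _ _).trans ?_
  have : ε * h = ∑ _i : S, (2 * ε' * h) := by
    rw [Finset.sum_const, Finset.card_univ, nsmul_eq_mul, hε']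
    have hc0 : (Fintype.card S : ℝ) ≠ 0 := by linarith
    field_simp
  rw [this]
  refine Finset.sum_le_sum fun i _ => ?_
  by_cases hij : i = j
  · subst hij
    have := mul_nonneg hε'0.le (le_of_lt hpos)
    simp only [sub_self, mul_zero, abs_zero]
    linarith
  · obtain ⟨h1, h2⟩ := hh i hij
    have h1 := abs_le.1 (h1 t ht)
    have h2 := abs_le.1 (h2 t ht)
    rw [abs_le]
    constructor <;> linarith [h1.1, h1.2, h2.1, h2.2]

lemma abs_netRate_le (hY : IsRandomWalkWithRates c ν P Y) (j : S) (t : ℝ) :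
    |netRate c (fun i => occ P Y i t) j| ≤ ∑ i, (|c i j| + |c j i|) := by
  refine (Finset.abs_sum_le_sum_abs _ _).trans (Finset.sum_le_sum fun i _ => ?_)
  refine (abs_sub _ _).trans ?_
  rw [abs_mul, abs_mul, abs_of_nonneg (occ_nonneg i t), abs_of_nonneg (occ_nonneg j t)]
  exact add_le_add (mul_le_of_le_one_right (abs_nonneg _) (occ_le_one hY i t))
    (mul_le_of_le_one_right (abs_nonneg _) (occ_le_one hY j t))

lemma continuous_occ (hY : IsRandomWalkWithRates c ν P Y) (j : S) : Continuous (occ P Y j) := by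
  set M := ∑ i, (|c i j| + |c j i|) with hM
  have hM0 : 0 ≤ M := Finset.sum_nonneg fun i _ => by positivity
  obtain ⟨η, hη, H⟩ := (mem_nhdsGT_iff_exists_Ioo_subset).1
    (eventually_increment hY j (zero_lt_one))
  -- A local Lipschitz estimate that is uniform in time gives continuity from both sides.
  have step : ∀ s t : ℝ, 0 ≤ s → s ≤ t → t - s < η →
      |occ P Y j t - occ P Y j s| ≤ (M + 1) * (t - s) := by
    intro s t hs hst hlt
    rcases hst.eq_or_lt with rfl | hst
    · simp
    have h1 := H ⟨sub_pos.2 hst, hlt⟩ s hs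
    rw [add_sub_cancel] at h1
    have h2 := abs_netRate_le hY j s
    have h3 : |(t - s) * netRate c (fun i => occ P Y i s) j| ≤ (t - s) * M := by
      rw [abs_mul, abs_of_pos (sub_pos.2 hst)]
      exact mul_le_mul_of_nonneg_left h2 (sub_pos.2 hst).le
    have h1 := abs_le.1 h1
    have h3 := abs_le.1 h3
    rw [abs_le]
    constructor <;> nlinarith [h1.1, h1.2, h3.1, h3.2]
  have hmax : ∀ t, occ P Y j t = occ P Y j (max t 0) := by
    intro t
    rw [occ, occ, ← Real.coe_toNNReal', Real.toNNReal_coe]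
  rw [Metric.continuous_iff]
  intro s ε hε
  refine ⟨min η (ε / (M + 1)), lt_min hη (by positivity), fun t ht => ?_⟩
  rw [hmax t, hmax s, Real.dist_eq]
  rw [Real.dist_eq] at ht
  have hd : |max t 0 - max s 0| ≤ |t - s| := abs_max_sub_max_le_abs t s 0
  have hlt := hd.trans_lt ht
  have h1 := hlt.trans_le (min_le_left _ _)
  have h2 : (M + 1) * |max t 0 - max s 0| < ε := by
    have := hlt.trans_le (min_le_right _ _)
    rw [lt_div_iff₀ (by positivity)] at this
    linarith
  rcases le_total (max s 0) (max t 0) with h | h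
  · rw [abs_of_nonneg (sub_nonneg.2 h)] at h1 h2
    exact (step _ _ (le_max_right _ _) h h1).trans_lt h2
  · rw [abs_sub_comm] at h1 h2 ⊢
    rw [abs_of_nonneg (sub_nonneg.2 h)] at h1 h2
    exact (step _ _ (le_max_right _ _) h h1).trans_lt h2

lemma hasDerivWithinAt_occ (hY : IsRandomWalkWithRates c ν P Y) (j : S) {t : ℝ} (ht : 0 ≤ t) :
    HasDerivWithinAt (occ P Y j) (netRate c (fun i => occ P Y i t) j) (Ioi t) t := by
  rw [hasDerivWithinAt_iff_isLittleO, Asymptotics.isLittleO_iff]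
  intro ε hε
  have h0 : Tendsto (fun y : ℝ => y - t) (𝓝[>] t) (𝓝[>] 0) := by
    refine tendsto_nhdsWithin_iff.2 ⟨?_, ?_⟩
    · have : Tendsto (fun y : ℝ => y - t) (𝓝 t) (𝓝 (t - t)) := tendsto_id.sub_const t
      rw [sub_self] at this
      exact this.mono_left nhdsWithin_le_nhds
    · filter_upwards [self_mem_nhdsWithin] with y hy
      exact sub_pos.2 (mem_Ioi.1 hy)
  filter_upwards [h0.eventually (eventually_increment hY j hε), self_mem_nhdsWithin] with y hy hyt
  have := hy t ht
  rw [add_sub_cancel] at this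
  rw [Real.norm_eq_abs, Real.norm_eq_abs, abs_of_pos (sub_pos.2 (mem_Ioi.1 hyt)), smul_eq_mul]
  exact this

/-- The forward equation. The rates only control right derivatives; these suffice, since the
occupation probabilities and their net rates are continuous. -/
theorem hasDerivAt_occ (hY : IsRandomWalkWithRates c ν P Y) (j : S) {t : ℝ} (ht : 0 < t) :
    HasDerivAt (occ P Y j) (netRate c (fun i => occ P Y i t) j) t := by
  have hc : Continuous fun t => netRate c (fun i => occ P Y i t) j :=
    continuous_finsetSum _ fun i _ =>
      ((continuous_occ hY i).const_mul _).sub ((continuous_occ hY j).const_mul _)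
  have hint : ∀ u : ℝ, 0 ≤ u → ∫ y in (0 : ℝ)..u, netRate c (fun i => occ P Y i y) j
      = occ P Y j u - occ P Y j 0 := fun u hu =>
    intervalIntegral.integral_eq_sub_of_hasDeriv_right_of_le hu (continuous_occ hY j).continuousOn
      (fun x hx => hasDerivWithinAt_occ hY j hx.1.le) (hc.intervalIntegrable _ _)
  have hd := (hc.integral_hasStrictDerivAt 0 t).hasDerivAt.const_add (occ P Y j 0)
  refine hd.congr_of_eventuallyEq ?_
  filter_upwards [lt_mem_nhds ht] with u hu
  rw [hint u hu.le]
  ring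

end Forward

/-! ### The trap model with finitely many sites -/

section Flow

variable {ι : Type*} [Fintype ι] {x : ι → ℝ} {p : ι → ℝ → ℝ}

/-- The expected jump rate `∑ x i * p i t` of the walk at time `t`. -/
def jumpRate (x : ι → ℝ) (p : ι → ℝ → ℝ) (t : ℝ) : ℝ := ∑ i, x i * p i t

/-- `p i t` solves the forward equation of the trap model on the complete graph `ι` with inverse
waiting times `x`, started from the uniform distribution. -/
structure IsTrapFlow (x : ι → ℝ) (p : ι → ℝ → ℝ) : Prop where
  continuous : ∀ i, Continuous (p i)
  hasDerivAt : ∀ i t, 0 < t →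
    HasDerivAt (p i) (jumpRate x p t / Fintype.card ι - x i * p i t) t
  initial : ∀ i, p i 0 = 1 / Fintype.card ι
  nonneg : ∀ i t, 0 ≤ p i t
  sum_eq_one : ∀ t, ∑ i, p i t = 1

namespace IsTrapFlow

lemma continuous_jumpRate (h : IsTrapFlow x p) : Continuous (jumpRate x p) :=
  continuous_finsetSum _ fun i _ => (h.continuous i).const_mul _

lemma jumpRate_nonneg (h : IsTrapFlow x p) (hx : ∀ i, 0 ≤ x i) (t : ℝ) : 0 ≤ jumpRate x p t :=
  Finset.sum_nonneg fun i _ => mul_nonneg (hx i) (h.nonneg i t)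

lemma jumpRate_le_one (h : IsTrapFlow x p) (hx : ∀ i, x i ≤ 1) (t : ℝ) : jumpRate x p t ≤ 1 := by
  rw [← h.sum_eq_one t]
  exact Finset.sum_le_sum fun i _ => mul_le_of_le_one_left (h.nonneg i t) (hx i)

/-- Variation of constants for the forward equation. -/
lemma duhamel (h : IsTrapFlow x p) (i : ι) {t : ℝ} (ht : 0 ≤ t) :
    p i t = Real.exp (-(x i * t)) / Fintype.card ι +
      ∫ u in (0 : ℝ)..t, Real.exp (-(x i * (t - u))) / Fintype.card ι * jumpRate x p u := by
  have hcont : Continuous fun u => Real.exp (x i * u) * p i u :=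
    (by fun_prop : Continuous fun u => Real.exp (x i * u)).mul (h.continuous i)
  have hder : ∀ u ∈ Ioo 0 t, HasDerivAt (fun u => Real.exp (x i * u) * p i u)
      (Real.exp (x i * u) / Fintype.card ι * jumpRate x p u) u := by
    intro u hu
    have h1 : HasDerivAt (fun u => Real.exp (x i * u)) (Real.exp (x i * u) * (x i * 1)) u :=
      ((hasDerivAt_id u).const_mul (x i)).exp
    refine (h1.mul (h.hasDerivAt i u hu.1)).congr_deriv ?_
    ring
  have hint := intervalIntegral.integral_eq_sub_of_hasDerivAt_of_le ht hcont.continuousOn hder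
    (((by fun_prop : Continuous fun u => Real.exp (x i * u) / (Fintype.card ι : ℝ)).mul
      h.continuous_jumpRate).intervalIntegrable _ _)
  have hfac : ∀ u, Real.exp (-(x i * (t - u))) / Fintype.card ι * jumpRate x p u
      = Real.exp (-(x i * t)) * (Real.exp (x i * u) / Fintype.card ι * jumpRate x p u) := by
    intro u
    have : Real.exp (-(x i * (t - u))) = Real.exp (-(x i * t)) * Real.exp (x i * u) := by
      rw [← Real.exp_add]; ring_nf
    rw [this]; ring
  simp_rw [hfac]
  rw [intervalIntegral.integral_const_mul, hint, h.initial i]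
  have : Real.exp (-(x i * t)) * Real.exp (x i * t) = 1 := by
    rw [← Real.exp_add]; simp
  simp only [mul_zero, Real.exp_zero]
  linear_combination -(p i t) * this

/-- The renewal equation: the expectation of any function of the state is obtained by
conditioning on the last jump; note that a jump leads to a uniformly distributed state. -/
lemma sum_mul_eq (h : IsTrapFlow x p) (g : ι → ℝ) {t : ℝ} (ht : 0 ≤ t) :
    ∑ i, g i * p i t = (∑ i, g i * Real.exp (-(x i * t))) / Fintype.card ι +
      ∫ u in (0 : ℝ)..t,
        (∑ i, g i * Real.exp (-(x i * (t - u)))) / Fintype.card ι * jumpRate x p u := by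
  have h1 : ∀ i, g i * p i t = g i * Real.exp (-(x i * t)) / Fintype.card ι +
      ∫ u in (0 : ℝ)..t,
        g i * (Real.exp (-(x i * (t - u))) / Fintype.card ι * jumpRate x p u) := by
    intro i
    rw [intervalIntegral.integral_const_mul, h.duhamel i ht]
    ring
  rw [Finset.sum_congr rfl fun i _ => h1 i, Finset.sum_add_distrib, ← Finset.sum_div,
    ← intervalIntegral.integral_finsetSum]
  · congr 1
    refine intervalIntegral.integral_congr fun u _ => ?_
    simp only [Finset.sum_div, Finset.sum_mul]
    exact Finset.sum_congr rfl fun i _ => by ring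
  · intro i _
    refine Continuous.intervalIntegrable ?_ _ _
    have := h.continuous_jumpRate
    fun_prop

/-- Reversibility: the walk is reversible with respect to the weights `1 / x i`, whence
`∑ x i * p i s * p i (t - s)` does not depend on `s`. -/
lemma jumpRate_eq_sum_sq (h : IsTrapFlow x p) [Nonempty ι] {t : ℝ} (ht : 0 ≤ t) :
    jumpRate x p t = Fintype.card ι * ∑ i, x i * p i (t / 2) ^ 2 := by
  set F : ℝ → ℝ := fun s => ∑ i, x i * (p i s * p i (t - s)) with hF
  have hcont : Continuous F := by
    have := h.continuous
    refine continuous_finsetSum _ fun i _ => ((this i).mul ?_).const_mul _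
    exact (this i).comp (by fun_prop)
  have hder : ∀ s ∈ Ioo 0 (t / 2), HasDerivAt F 0 s := by
    intro s hs
    have h1 : ∀ i ∈ Finset.univ, HasDerivAt (fun s => x i * (p i s * p i (t - s)))
        (x i * ((jumpRate x p s / Fintype.card ι - x i * p i s) * p i (t - s) +
          p i s * -(jumpRate x p (t - s) / Fintype.card ι - x i * p i (t - s)))) s := by
      intro i _
      have h2 := (h.hasDerivAt i (t - s) (by linarith [hs.1, hs.2])).scomp s
        ((hasDerivAt_id s).const_sub t)
      have h3 := ((h.hasDerivAt i s hs.1).mul h2).const_mul (x i)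
      refine h3.congr_deriv ?_
      simp
    refine (HasDerivAt.fun_sum h1).congr_deriv ?_
    have e : ∀ i, x i * ((jumpRate x p s / Fintype.card ι - x i * p i s) * p i (t - s) +
          p i s * -(jumpRate x p (t - s) / Fintype.card ι - x i * p i (t - s)))
        = jumpRate x p s / Fintype.card ι * (x i * p i (t - s))
          - jumpRate x p (t - s) / Fintype.card ι * (x i * p i s) := fun i => by ring
    rw [Finset.sum_congr rfl fun i _ => e i, Finset.sum_sub_distrib, ← Finset.mul_sum,
      ← Finset.mul_sum]
    change _ * jumpRate x p (t - s) - _ * jumpRate x p s = 0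
    ring
  have hconst := intervalIntegral.integral_eq_sub_of_hasDerivAt_of_le (by linarith)
    hcont.continuousOn hder (intervalIntegrable_const (c := (0 : ℝ)))
  simp only [intervalIntegral.integral_zero] at hconst
  have h0 : F 0 = jumpRate x p t / Fintype.card ι := by
    simp only [hF, jumpRate, sub_zero, h.initial, Finset.sum_div]
    exact Finset.sum_congr rfl fun i _ => by ring
  have h1 : F (t / 2) = ∑ i, x i * p i (t / 2) ^ 2 := by
    simp only [hF]
    refine Finset.sum_congr rfl fun i _ => ?_
    rw [sub_half, sq]
  rw [← h1, show F (t / 2) = F 0 by linarith, h0]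
  field_simp

/-- By reversibility the expected jump rate decreases. -/
lemma antitoneOn_jumpRate (h : IsTrapFlow x p) [Nonempty ι] :
    AntitoneOn (jumpRate x p) (Ici 0) := by
  set Q : ℝ → ℝ := fun s => ∑ i, x i * p i s ^ 2 with hQ
  have hQd : ∀ s, 0 < s → HasDerivAt Q
      (2 * (jumpRate x p s ^ 2 / Fintype.card ι - ∑ i, (x i * p i s) ^ 2)) s := by
    intro s hs
    have h1 : ∀ i ∈ Finset.univ, HasDerivAt (fun s => x i * p i s ^ 2)
        (x i * (2 * p i s * (jumpRate x p s / Fintype.card ι - x i * p i s))) s := by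
      intro i _
      refine (((h.hasDerivAt i s hs).pow 2).const_mul (x i)).congr_deriv ?_
      simp
    refine (HasDerivAt.fun_sum h1).congr_deriv ?_
    have e : ∀ i, x i * (2 * p i s * (jumpRate x p s / Fintype.card ι - x i * p i s))
        = 2 * (jumpRate x p s / Fintype.card ι * (x i * p i s) - (x i * p i s) ^ 2) :=
      fun i => by ring
    rw [Finset.sum_congr rfl fun i _ => e i, ← Finset.mul_sum, Finset.sum_sub_distrib,
      ← Finset.mul_sum]
    change 2 * (_ * jumpRate x p s - _) = _
    ring
  have hQa : AntitoneOn Q (Ici 0) := by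
    refine antitoneOn_of_deriv_nonpos (convex_Ici 0) ?_ ?_ ?_
    · exact (continuous_finsetSum _ fun i _ =>
        ((h.continuous i).pow 2).const_mul _).continuousOn
    · intro s hs
      rw [interior_Ici] at hs
      exact (hQd s hs).differentiableAt.differentiableWithinAt
    · intro s hs
      rw [interior_Ici] at hs
      rw [(hQd s hs).deriv]
      have hcs : jumpRate x p s ^ 2 ≤ Fintype.card ι * ∑ i, (x i * p i s) ^ 2 :=
        sq_sum_le_card_mul_sum_sq
      have hn : (0 : ℝ) < Fintype.card ι := by exact_mod_cast Fintype.card_pos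
      have : jumpRate x p s ^ 2 / Fintype.card ι ≤ ∑ i, (x i * p i s) ^ 2 := by
        rw [div_le_iff₀ hn]; linarith
      linarith
  intro s hs t ht hst
  rw [h.jumpRate_eq_sum_sq hs, h.jumpRate_eq_sum_sq ht]
  refine mul_le_mul_of_nonneg_left ?_ (Nat.cast_nonneg _)
  simp only [mem_Ici] at hs ht
  exact hQa (show (0 : ℝ) ≤ s / 2 by linarith) (show (0 : ℝ) ≤ t / 2 by linarith) (by linarith)

end IsTrapFlow

end Flow

/-- The occupation probabilities of the walk solve the forward equation. -/
lemma IsREMTrapWalk.isTrapFlow {e : ℕ → ℝ} {N : ℕ} {Ω' : Type*} [MeasurableSpace Ω']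
    {P : Measure Ω'} {Y : ℝ≥0 → Ω' → Fin (N + 1)} (hY : IsREMTrapWalk e (N + 1) P Y) :
    IsTrapFlow (fun i : Fin (N + 1) => invWait e i) (occ P Y) where
  continuous := continuous_occ hY
  hasDerivAt i t ht := by
    refine (hasDerivAt_occ hY i ht).congr_deriv ?_
    simp only [netRate, jumpRate, Finset.sum_sub_distrib, Finset.sum_const, Finset.card_univ,
      Fintype.card_fin, nsmul_eq_mul, Finset.sum_div]
    congr 1
    · exact Finset.sum_congr rfl fun j _ => by ring
    · field_simp
  initial i := by
    have h := hY.initial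
    have := congrArg (fun m => m.real {i}) h
    rw [occ, Real.toNNReal_zero]
    rw [map_measureReal_apply (hY.measurable 0) (measurableSet_singleton i)] at this
    refine this.trans ?_
    rw [measureReal_def, uniformOn_univ]
    simp only [Measure.count_singleton, ENNReal.toReal_div, ENNReal.toReal_one, Fintype.card_fin,
      ENNReal.toReal_natCast]
  nonneg := occ_nonneg
  sum_eq_one := sum_occ hY

/-! ### The law of the inverse waiting times -/

section Law

/-- The law of `exp (-E)` for an exponential variable `E` with parameter `α`. -/
noncomputable def invLaw (α : ℝ) : Measure ℝ := (expMeasure α).map fun y => Real.exp (-y)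

variable {α : ℝ}

lemma measurableEmbedding_exp_neg : MeasurableEmbedding fun y : ℝ => Real.exp (-y) :=
  Continuous.measurableEmbedding (by fun_prop) fun a b h => by simpa using h

lemma isProbabilityMeasure_invLaw (hα : 0 < α) : IsProbabilityMeasure (invLaw α) := by
  have := isProbabilityMeasure_expMeasure hα
  exact Measure.isProbabilityMeasure_map (by fun_prop)

/-- The law of `exp (-E)` has density `α * x ^ (α - 1)` on `(0, 1)`. -/
lemma integral_invLaw (hα : 0 < α) (g : ℝ → ℝ) :
    ∫ x, g x ∂invLaw α = ∫ x in Ioo (0 : ℝ) 1, α * x ^ (α - 1) * g x := by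
  have hpdf : expMeasure α = (volume : Measure ℝ).withDensity (exponentialPDF α) := rfl
  have himg : (fun y : ℝ => Real.exp (-y)) '' Ioi 0 = Ioo 0 1 := by
    ext x
    constructor
    · rintro ⟨y, hy, rfl⟩
      exact ⟨Real.exp_pos _, by simpa using hy⟩
    · intro hx
      exact ⟨-Real.log x, by simpa using Real.log_neg hx.1 hx.2, by simp [Real.exp_log hx.1]⟩
  have hmeas : Measurable (exponentialPDF α) := (measurable_exponentialPDFReal α).ennreal_ofReal
  rw [invLaw, measurableEmbedding_exp_neg.integral_map, hpdf,
    integral_withDensity_eq_integral_toReal_smul hmeas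
      (Eventually.of_forall fun x => ENNReal.ofReal_lt_top), ← himg,
    integral_image_eq_integral_abs_deriv_smul measurableSet_Ioi
      (f' := fun y => Real.exp (-y) * (-1))
      (fun y _ => ((hasDerivAt_neg y).exp).hasDerivWithinAt)
      (measurableEmbedding_exp_neg.injective.injOn),
    ← integral_indicator measurableSet_Ioi]
  refine integral_congr_ae ?_
  have h0 : ∀ᵐ y : ℝ, y ≠ 0 := by simp [ae_iff]
  filter_upwards [h0] with y hy0
  rw [exponentialPDF_eq]
  by_cases hy : 0 < y
  · rw [indicator_of_mem (by exact hy), if_pos hy.le,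
      ENNReal.toReal_ofReal (by positivity), smul_eq_mul, smul_eq_mul, mul_neg_one, abs_neg,
      abs_of_pos (Real.exp_pos _), ← Real.exp_mul]
    have : Real.exp (-(α * y)) = Real.exp (-y) * Real.exp (-y * (α - 1)) := by
      rw [← Real.exp_add]; ring_nf
    rw [this]; ring
  · rw [indicator_of_notMem (by exact hy), if_neg (by
      rw [not_le]; exact lt_of_le_of_ne (not_lt.1 hy) hy0)]
    simp

lemma ae_mem_Ioo_invLaw (hα : 0 < α) : ∀ᵐ x ∂invLaw α, x ∈ Ioo (0 : ℝ) 1 := by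
  have := isProbabilityMeasure_invLaw hα
  have h1 : ∫ x, (Ioo (0 : ℝ) 1)ᶜ.indicator (fun _ => (1 : ℝ)) x ∂invLaw α = 0 := by
    rw [integral_invLaw hα]
    refine setIntegral_eq_zero_of_forall_eq_zero fun x hx => ?_
    rw [indicator_of_notMem (by simpa using hx), mul_zero]
  rw [integral_indicator measurableSet_Ioo.compl, setIntegral_const, smul_eq_mul, mul_one,
    measureReal_eq_zero_iff] at h1
  exact h1

lemma ae_ne_invLaw (hα : 0 < α) (a : ℝ) : ∀ᵐ x ∂invLaw α, x ≠ a := by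
  have := isProbabilityMeasure_invLaw hα
  have h1 : ∫ x, ({a} : Set ℝ).indicator (fun _ => (1 : ℝ)) x ∂invLaw α = 0 := by
    rw [integral_invLaw hα]
    refine integral_eq_zero_of_ae (ae_restrict_of_ae ?_)
    have h0 : ∀ᵐ y : ℝ, y ≠ a := by simp [ae_iff]
    filter_upwards [h0] with y hy
    rw [indicator_of_notMem (by simpa using hy), mul_zero, Pi.zero_apply]
  rw [integral_indicator (measurableSet_singleton a), setIntegral_const, smul_eq_mul, mul_one,
    measureReal_eq_zero_iff] at h1
  rw [ae_iff]
  simpa using h1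

lemma continuousAt_integral_invLaw (hα : 0 < α) {F : ℝ → ℝ → ℝ} {s₀ C : ℝ}
    (hm : ∀ s, Measurable (F s)) (hb : ∀ᶠ s in 𝓝 s₀, ∀ x ∈ Ioo (0 : ℝ) 1, |F s x| ≤ C)
    (hc : ∀ᵐ x ∂invLaw α, ContinuousAt (fun s => F s x) s₀) :
    ContinuousAt (fun s => ∫ x, F s x ∂invLaw α) s₀ := by
  have := isProbabilityMeasure_invLaw hα
  refine continuousAt_of_dominated (bound := fun _ => C)
    (Eventually.of_forall fun s => (hm s).aestronglyMeasurable) ?_ (integrable_const C) hc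
  filter_upwards [hb] with s hs
  filter_upwards [ae_mem_Ioo_invLaw hα] with x hx
  exact hs x hx

/-- The function `x ↦ exp (-x t)`, cut off to `0` for `x ≤ δ`. -/
noncomputable def tailKernel (δ t x : ℝ) : ℝ := if δ < x then Real.exp (-(x * t)) else 0

/-- The expectation of `tailKernel δ t`: the limit of infinitely many sites of the probability that
a uniformly distributed site has inverse waiting time above `δ` and is not left before time `t`. -/
noncomputable def meanTail (α δ t : ℝ) : ℝ := ∫ x, tailKernel δ t x ∂invLaw α

/-- The expectation of `x * exp (-x t)`: the density of the time between two jumps in the limit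
of infinitely many sites. -/
noncomputable def meanRate (α t : ℝ) : ℝ := ∫ x, x * Real.exp (-(x * t)) ∂invLaw α

lemma measurable_tailKernel (δ t : ℝ) : Measurable (tailKernel δ t) :=
  Measurable.ite measurableSet_Ioi (by fun_prop) measurable_const

lemma tailKernel_nonneg (δ t x : ℝ) : 0 ≤ tailKernel δ t x := by
  unfold tailKernel; split_ifs <;> positivity

lemma exp_neg_mul_le {s t x : ℝ} (hx : x ∈ Ioo (0 : ℝ) 1) (hs : |s| ≤ t) :
    Real.exp (-(x * s)) ≤ Real.exp t := by
  refine Real.exp_le_exp.2 ((le_abs_self _).trans ?_)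
  rw [abs_neg, abs_mul, abs_of_pos hx.1]
  exact (mul_le_of_le_one_left (abs_nonneg _) hx.2.le).trans hs

lemma abs_tailKernel_le {δ s t x : ℝ} (hx : x ∈ Ioo (0 : ℝ) 1) (hs : |s| ≤ t) :
    |tailKernel δ s x| ≤ Real.exp t := by
  rw [abs_of_nonneg (tailKernel_nonneg _ _ _)]
  unfold tailKernel; split_ifs
  · exact exp_neg_mul_le hx hs
  · positivity

lemma eventually_abs_le_add_one (t : ℝ) : ∀ᶠ s in 𝓝 t, |s| ≤ |t| + 1 :=
  (continuous_abs.tendsto t).eventually (eventually_le_nhds (lt_add_one _))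

lemma continuous_meanTail (hα : 0 < α) (δ : ℝ) : Continuous (meanTail α δ) := by
  refine continuous_iff_continuousAt.2 fun t => ?_
  refine continuousAt_integral_invLaw hα (fun s => measurable_tailKernel δ s)
    ((eventually_abs_le_add_one t).mono fun s hs x hx => abs_tailKernel_le hx hs)
    (Eventually.of_forall fun x => ?_)
  unfold tailKernel
  split_ifs
  · fun_prop
  · fun_prop

/-- Continuity in the threshold, as the law has no atoms. -/
lemma continuous_meanTail_left (hα : 0 < α) (t : ℝ) : Continuous fun δ => meanTail α δ t := by
  refine continuous_iff_continuousAt.2 fun δ₀ => ?_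
  refine continuousAt_integral_invLaw hα (fun δ => measurable_tailKernel δ t)
    (Eventually.of_forall fun s x hx => abs_tailKernel_le hx le_rfl) ?_
  filter_upwards [ae_ne_invLaw hα δ₀] with x hx
  refine (continuousAt_const : ContinuousAt (fun _ => tailKernel δ₀ t x) δ₀).congr ?_
  rcases lt_or_gt_of_ne hx with h | h
  · filter_upwards [lt_mem_nhds h] with δ hδ
    simp [tailKernel, not_lt.2 hδ.le, not_lt.2 h.le]
  · filter_upwards [gt_mem_nhds h] with δ hδ
    simp [tailKernel, hδ, h]

lemma continuous_meanRate (hα : 0 < α) : Continuous (meanRate α) := by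
  refine continuous_iff_continuousAt.2 fun t => ?_
  refine continuousAt_integral_invLaw hα (C := Real.exp (|t| + 1)) (fun s => by fun_prop)
    ((eventually_abs_le_add_one t).mono fun s hs x hx => ?_)
    (Eventually.of_forall fun x => by fun_prop)
  · rw [abs_mul, abs_of_pos hx.1, Real.abs_exp]
    exact (mul_le_of_le_one_left (Real.exp_pos _).le hx.2.le).trans (exp_neg_mul_le hx hs)

end Law

/-! ### Typical landscapes -/

section Landscape

/-- Pointwise convergence of antitone functions to a continuous limit need only be checked at
rational points. -/
lemma tendsto_of_antitone_of_rat {g : ℕ → ℝ → ℝ} {G : ℝ → ℝ} (hg : ∀ n, Antitone (g n))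
    (hG : Continuous G) (h : ∀ q : ℚ, Tendsto (fun n => g n q) atTop (𝓝 (G q))) (t : ℝ) :
    Tendsto (fun n => g n t) atTop (𝓝 (G t)) := by
  refine tendsto_order.2 ⟨fun a ha => ?_, fun a ha => ?_⟩
  · obtain ⟨u, hu, H⟩ := exists_Ico_subset_of_mem_nhds
      (hG.continuousAt.preimage_mem_nhds (Ioi_mem_nhds ha)) (exists_gt t)
    obtain ⟨q, hq1, hq2⟩ := exists_rat_btwn hu
    have h1 : a < G q := H ⟨hq1.le, hq2⟩
    filter_upwards [(h q).eventually (lt_mem_nhds h1)] with n hn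
    exact hn.trans_le (hg n hq1.le)
  · obtain ⟨u, hu, H⟩ := exists_Ioc_subset_of_mem_nhds
      (hG.continuousAt.preimage_mem_nhds (Iio_mem_nhds ha)) (exists_lt t)
    obtain ⟨q, hq1, hq2⟩ := exists_rat_btwn hu
    have h1 : G q < a := H ⟨hq1, hq2.le⟩
    filter_upwards [(h q).eventually (gt_mem_nhds h1)] with n hn
    exact (hg n hq2.le).trans_lt hn

/-- A landscape `x` of inverse waiting times is typical if the empirical averages needed below
converge to their expectations. -/
structure IsTypical (α : ℝ) (x : ℕ → ℝ) : Prop where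
  mem_Ioo : ∀ i, x i ∈ Ioo (0 : ℝ) 1
  tendsto_rate : ∀ t : ℝ, Tendsto
    (fun n : ℕ => (∑ i ∈ Finset.range n, x i * Real.exp (-(x i * t))) / n) atTop
    (𝓝 (meanRate α t))
  tendsto_tail : ∀ δ t : ℝ, Tendsto
    (fun n : ℕ => (∑ i ∈ Finset.range n, tailKernel δ t (x i)) / n) atTop (𝓝 (meanTail α δ t))

variable {α : ℝ} {Ω : Type*} [MeasurableSpace Ω] {μ : Measure Ω} [IsProbabilityMeasure μ]
  {E : ℕ → Ω → ℝ}

lemma ae_tendsto_average (hα : 0 < α) (hindep : iIndepFun E μ)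
    (hlaw : ∀ i, HasLaw (E i) (expMeasure α) μ) {g : ℝ → ℝ} {C : ℝ} (hg : Measurable g)
    (hb : ∀ x ∈ Ioo (0 : ℝ) 1, |g x| ≤ C) :
    ∀ᵐ ω ∂μ, Tendsto
      (fun n : ℕ => (∑ i ∈ Finset.range n, g (invWait (fun i => E i ω) i)) / n) atTop
      (𝓝 (∫ x, g x ∂invLaw α)) := by
  have hX : ∀ i, HasLaw (fun ω => Real.exp (-E i ω)) (invLaw α) μ := fun i =>
    HasLaw.fun_comp (X := E i) (Y := fun y => Real.exp (-y)) ⟨by fun_prop, rfl⟩ (hlaw i)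
  have hint : Integrable (fun ω => g (Real.exp (-E 0 ω))) μ := by
    refine Integrable.of_bound (C := C)
      (hg.comp_aemeasurable (hX 0).aemeasurable).aestronglyMeasurable ?_
    have h1 := ae_mem_Ioo_invLaw hα
    rw [← (hX 0).map_eq] at h1
    filter_upwards [ae_of_ae_map (hX 0).aemeasurable h1] with ω hω
    exact hb _ hω
  have hme : Measurable fun y : ℝ => g (Real.exp (-y)) := hg.comp (by fun_prop)
  have := strong_law_ae_real (μ := μ) (fun i ω => g (Real.exp (-E i ω))) hint
    (fun i j hij => (hindep.indepFun hij).comp hme hme)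
    (fun i => ((hX i).identDistrib (hX 0)).comp hg)
  have hval : ∫ ω, g (Real.exp (-E 0 ω)) ∂μ = ∫ x, g x ∂invLaw α :=
    (hX 0).integral_comp hg.aestronglyMeasurable
  rw [hval] at this
  exact this

/-- Almost every landscape is typical, by the strong law of large numbers at rational parameters
and monotonicity in the parameters. -/
theorem ae_isTypical (hα : 0 < α) (hindep : iIndepFun E μ)
    (hlaw : ∀ i, HasLaw (E i) (expMeasure α) μ) :
    ∀ᵐ ω ∂μ, IsTypical α (invWait fun i => E i ω) := by
  have h1 : ∀ᵐ ω ∂μ, ∀ i, invWait (fun i => E i ω) i ∈ Ioo (0 : ℝ) 1 := by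
    refine ae_all_iff.2 fun i => ?_
    have h1 := ae_mem_Ioo_invLaw hα
    have hX : HasLaw (fun ω => Real.exp (-E i ω)) (invLaw α) μ :=
      HasLaw.fun_comp (X := E i) (Y := fun y => Real.exp (-y)) ⟨by fun_prop, rfl⟩ (hlaw i)
    rw [← hX.map_eq] at h1
    exact ae_of_ae_map hX.aemeasurable h1
  have h2 := ae_all_iff.2 fun q : ℚ => ae_tendsto_average (C := Real.exp |(q : ℝ)|) hα hindep hlaw
    (g := fun x => x * Real.exp (-(x * q))) (by fun_prop) (fun x hx => by
      rw [abs_mul, abs_of_pos hx.1, Real.abs_exp]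
      exact (mul_le_of_le_one_left (Real.exp_pos _).le hx.2.le).trans (exp_neg_mul_le hx le_rfl))
  have h3 := ae_all_iff.2 fun δ : ℚ => ae_all_iff.2 fun q : ℚ =>
    ae_tendsto_average (C := Real.exp |(q : ℝ)|) hα hindep hlaw
    (g := tailKernel δ q) (measurable_tailKernel _ _) (fun x hx => abs_tailKernel_le hx le_rfl)
  filter_upwards [h1, h2, h3] with ω h1 h2 h3
  have hexp : ∀ i s t, s ≤ t → Real.exp (-(invWait (fun i => E i ω) i * t))
      ≤ Real.exp (-(invWait (fun i => E i ω) i * s)) := fun i s t hst =>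
    Real.exp_le_exp.2 (neg_le_neg (mul_le_mul_of_nonneg_left hst (h1 i).1.le))
  refine ⟨h1, fun t => ?_, fun δ t => ?_⟩
  · refine tendsto_of_antitone_of_rat (g := fun (n : ℕ) t => (∑ i ∈ Finset.range n,
      invWait (fun i => E i ω) i * Real.exp (-(invWait (fun i => E i ω) i * t))) / (n : ℝ))
      (fun n s t hst => ?_) (continuous_meanRate hα) h2 t
    refine div_le_div_of_nonneg_right (Finset.sum_le_sum fun i _ => ?_) (Nat.cast_nonneg _)
    exact mul_le_mul_of_nonneg_left (hexp i s t hst) (h1 i).1.le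
  · refine tendsto_of_antitone_of_rat (g := fun (n : ℕ) δ => (∑ i ∈ Finset.range n,
      tailKernel δ t (invWait (fun i => E i ω) i)) / (n : ℝ)) (G := fun δ => meanTail α δ t)
      (fun n s u hsu => ?_) (continuous_meanTail_left hα t) (fun q => ?_) δ
    · refine div_le_div_of_nonneg_right (Finset.sum_le_sum fun i _ => ?_) (Nat.cast_nonneg _)
      unfold tailKernel
      split_ifs with ha hb
      · exact le_rfl
      · exact absurd (hsu.trans_lt ha) hb
      · positivity
      · exact le_rfl
    · refine tendsto_of_antitone_of_rat (g := fun (n : ℕ) t => (∑ i ∈ Finset.range n,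
        tailKernel q t (invWait (fun i => E i ω) i)) / (n : ℝ))
        (fun n s u hsu => ?_) (continuous_meanTail hα q) (h3 q) t
      refine div_le_div_of_nonneg_right (Finset.sum_le_sum fun i _ => ?_) (Nat.cast_nonneg _)
      unfold tailKernel
      split_ifs
      · exact hexp i s u hsu
      · exact le_rfl

end Landscape

/-! ### Renewal equations -/

section Volterra

/-- The convolution of two functions on `[0, ∞)`. -/
noncomputable def conv (f ψ : ℝ → ℝ) (t : ℝ) : ℝ := ∫ u in (0 : ℝ)..t, f (t - u) * ψ u

/-- An integral form of Grönwall's inequality. -/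
lemma le_exp_of_le_add_integral {d : ℝ → ℝ} {ε T : ℝ} (hd : Continuous d) (hd0 : ∀ t, 0 ≤ d t)
    (h : ∀ t ∈ Icc 0 T, d t ≤ ε + ∫ u in (0 : ℝ)..t, d u) {t : ℝ} (ht : t ∈ Icc 0 T) :
    d t ≤ 2 * ε * Real.exp (2 * t) := by
  have hcont : Continuous fun t => Real.exp (-(2 * t)) * d t :=
    (by fun_prop : Continuous fun t : ℝ => Real.exp (-(2 * t))).mul hd
  obtain ⟨r, hr, hmax⟩ := isCompact_Icc.exists_isMaxOn ⟨t, ht⟩ hcont.continuousOn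
  set M := Real.exp (-(2 * r)) * d r with hM
  have hM0 : 0 ≤ M := mul_nonneg (Real.exp_pos _).le (hd0 r)
  have hdM : ∀ u ∈ Icc 0 T, d u ≤ M * Real.exp (2 * u) := by
    intro u hu
    have h1 : Real.exp (-(2 * u)) * d u ≤ M := hmax hu
    rw [Real.exp_neg, inv_mul_le_iff₀ (Real.exp_pos _)] at h1
    linarith
  have hint : ∫ u in (0 : ℝ)..r, M * Real.exp (2 * u) = M * ((Real.exp (2 * r) - 1) / 2) := by
    have := intervalIntegral.integral_eq_sub_of_hasDerivAt (a := 0) (b := r)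
      (f := fun u => M * (Real.exp (2 * u) / 2)) (f' := fun u => M * Real.exp (2 * u))
      (fun u _ => by
        have h1 : HasDerivAt (fun u : ℝ => Real.exp (2 * u)) (Real.exp (2 * u) * (2 * 1)) u :=
          ((hasDerivAt_id u).const_mul 2).exp
        refine ((h1.div_const 2).const_mul M).congr_deriv ?_
        ring)
      ((by fun_prop : Continuous fun u : ℝ => M * Real.exp (2 * u)).intervalIntegrable _ _)
    rw [this]; simp; ring
  have h1 : d r ≤ ε + M * ((Real.exp (2 * r) - 1) / 2) := by
    refine (h r hr).trans ?_
    rw [← hint]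
    gcongr
    exact intervalIntegral.integral_mono_on hr.1 (hd.intervalIntegrable _ _)
      ((by fun_prop : Continuous fun u : ℝ => M * Real.exp (2 * u)).intervalIntegrable _ _)
      fun u hu => hdM u ⟨hu.1, hu.2.trans hr.2⟩
  have h2 : d r = M * Real.exp (2 * r) := by
    rw [hM, mul_right_comm, ← Real.exp_add]; simp
  have h3 : M ≤ 2 * ε := by
    have h4 : 1 ≤ Real.exp (2 * r) := Real.one_le_exp (by linarith [hr.1])
    rw [h2] at h1
    nlinarith
  exact (hdM t ht).trans (mul_le_mul_of_nonneg_right h3 (Real.exp_pos _).le)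

/-- The solution of a renewal equation depends continuously on the kernel. -/
lemma abs_sub_le_of_renewal {f₁ f₂ ψ₁ ψ₂ : ℝ → ℝ} (hf₁ : Continuous f₁) (hf₂ : Continuous f₂)
    (hψ₁ : Continuous ψ₁) (hψ₂ : Continuous ψ₂) (hb : ∀ t, 0 ≤ t → |f₂ t| ≤ 1)
    (hψb : ∀ t, |ψ₁ t| ≤ 1) (h₁ : ∀ t, 0 ≤ t → ψ₁ t = f₁ t + conv f₁ ψ₁ t)
    (h₂ : ∀ t, 0 ≤ t → ψ₂ t = f₂ t + conv f₂ ψ₂ t) {t : ℝ} (ht : 0 ≤ t) :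
    |ψ₁ t - ψ₂ t| ≤ |f₁ t - f₂ t| +
      4 * Real.exp (2 * t) * ∫ u in (0 : ℝ)..t, |f₁ u - f₂ u| := by
  set R : ℝ → ℝ := fun s => ∫ u in (0 : ℝ)..s, |f₁ u - f₂ u| with hR
  set d : ℝ → ℝ := fun s => |ψ₁ s - ψ₂ s - (f₁ s - f₂ s)| with hdef
  have hdc : Continuous d := by fun_prop
  have hfc : Continuous fun u => |f₁ u - f₂ u| := by fun_prop
  have hd : ∀ s ∈ Icc 0 t, d s ≤ 2 * R t + ∫ u in (0 : ℝ)..s, d u := by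
    intro s hs
    have hRs : R s ≤ R t := by
      refine intervalIntegral.integral_mono_interval le_rfl hs.1 hs.2
        (Eventually.of_forall fun u => abs_nonneg _) (hfc.intervalIntegrable _ _)
    have e1 : ψ₁ s - ψ₂ s - (f₁ s - f₂ s) =
        ∫ u in (0 : ℝ)..s, (f₁ (s - u) * ψ₁ u - f₂ (s - u) * ψ₂ u) := by
      rw [intervalIntegral.integral_sub]
      · rw [h₁ s hs.1, h₂ s hs.1, conv, conv]; ring
      · exact Continuous.intervalIntegrable (by fun_prop) _ _
      · exact Continuous.intervalIntegrable (by fun_prop) _ _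
    have e2 : d s ≤ ∫ u in (0 : ℝ)..s, (|f₁ (s - u) - f₂ (s - u)| + (d u + |f₁ u - f₂ u|)) := by
      simp only [hdef]
      rw [e1, ← Real.norm_eq_abs]
      refine intervalIntegral.norm_integral_le_of_norm_le (μ := volume)
        (g := fun u => |f₁ (s - u) - f₂ (s - u)| + (d u + |f₁ u - f₂ u|)) hs.1
        (Eventually.of_forall fun u hu => ?_)
        (Continuous.intervalIntegrable (by fun_prop) _ _)
      rw [Real.norm_eq_abs]
      have e3 : f₁ (s - u) * ψ₁ u - f₂ (s - u) * ψ₂ u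
          = (f₁ (s - u) - f₂ (s - u)) * ψ₁ u + f₂ (s - u) * (ψ₁ u - ψ₂ u) := by ring
      rw [e3]
      refine (abs_add_le _ _).trans (add_le_add ?_ ?_)
      · rw [abs_mul]
        exact mul_le_of_le_one_right (abs_nonneg _) (hψb u)
      · rw [abs_mul]
        refine (mul_le_of_le_one_left (abs_nonneg _) (hb _ (by linarith [hu.2]))).trans ?_
        have : ψ₁ u - ψ₂ u = (ψ₁ u - ψ₂ u - (f₁ u - f₂ u)) + (f₁ u - f₂ u) := by ring
        nth_rewrite 1 [this]
        exact abs_add_le _ _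
    rw [intervalIntegral.integral_add (Continuous.intervalIntegrable (by fun_prop) _ _)
      (Continuous.intervalIntegrable (by fun_prop) _ _),
      intervalIntegral.integral_add (hdc.intervalIntegrable _ _) (hfc.intervalIntegrable _ _),
      intervalIntegral.integral_comp_sub_left (fun u => |f₁ u - f₂ u|) s, sub_self, sub_zero] at e2
    change d s ≤ R s + (_ + R s) at e2
    linarith
  have hdt := le_exp_of_le_add_integral hdc (fun _ => abs_nonneg _) hd ⟨ht, le_rfl⟩
  have : ψ₁ t - ψ₂ t = (ψ₁ t - ψ₂ t - (f₁ t - f₂ t)) + (f₁ t - f₂ t) := by ring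
  calc |ψ₁ t - ψ₂ t| ≤ d t + |f₁ t - f₂ t| := by
        nth_rewrite 1 [this]
        exact abs_add_le _ _
    _ ≤ 2 * (2 * R t) * Real.exp (2 * t) + |f₁ t - f₂ t| := by gcongr
    _ = _ := by ring

/-- Solutions of renewal equations converge pointwise if their kernels do. -/
lemma cauchySeq_of_renewal {f ψ : ℕ → ℝ → ℝ} {f' : ℝ → ℝ} (hf : ∀ n, Continuous (f n))
    (hψ : ∀ n, Continuous (ψ n)) (hb : ∀ n t, 0 ≤ t → |f n t| ≤ 1) (hψb : ∀ n t, |ψ n t| ≤ 1)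
    (h : ∀ n t, 0 ≤ t → ψ n t = f n t + conv (f n) (ψ n) t)
    (hlim : ∀ t, 0 ≤ t → Tendsto (fun n => f n t) atTop (𝓝 (f' t))) {t : ℝ} (ht : 0 ≤ t) :
    CauchySeq fun n => ψ n t := by
  have hz : ∀ u, 0 ≤ u → Tendsto (fun q : ℕ × ℕ => |f q.1 u - f q.2 u|) atTop (𝓝 0) := by
    intro u hu
    have h1 : Tendsto (fun q : ℕ × ℕ => f q.1 u) atTop (𝓝 (f' u)) :=
      (hlim u hu).comp (by rw [← prod_atTop_atTop_eq]; exact tendsto_fst)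
    have h2 : Tendsto (fun q : ℕ × ℕ => f q.2 u) atTop (𝓝 (f' u)) :=
      (hlim u hu).comp (by rw [← prod_atTop_atTop_eq]; exact tendsto_snd)
    simpa using (h1.sub h2).abs
  have hI : Tendsto (fun q : ℕ × ℕ => ∫ u in (0 : ℝ)..t, |f q.1 u - f q.2 u|) atTop
      (𝓝 (∫ _u in (0 : ℝ)..t, (0 : ℝ))) := by
    refine intervalIntegral.tendsto_integral_filter_of_dominated_convergence (fun _ => 2)
      (Eventually.of_forall fun q => ?_) (Eventually.of_forall fun q =>
        Eventually.of_forall fun u hu => ?_) intervalIntegrable_const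
      (Eventually.of_forall fun u hu => ?_)
    · have := hf q.1
      have := hf q.2
      exact Continuous.aestronglyMeasurable (by fun_prop)
    · rw [uIoc_of_le ht] at hu
      rw [Real.norm_eq_abs, abs_abs]
      refine (abs_sub _ _).trans ?_
      linarith [hb q.1 u hu.1.le, hb q.2 u hu.1.le]
    · rw [uIoc_of_le ht] at hu
      exact hz u hu.1.le
  rw [intervalIntegral.integral_zero] at hI
  have hbound := (hz t ht).add (hI.const_mul (4 * Real.exp (2 * t)))
  rw [mul_zero, add_zero] at hbound
  rw [Metric.cauchySeq_iff]
  intro ε hε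
  obtain ⟨⟨n, m⟩, hnm⟩ := eventually_atTop.1 (hbound.eventually (gt_mem_nhds hε))
  refine ⟨max n m, fun a ha b hb' => ?_⟩
  rw [Real.dist_eq]
  exact (abs_sub_le_of_renewal (hf a) (hf b) (hψ a) (hψ b) (hb b) (hψb a) (h a) (h b) ht).trans_lt
    (hnm (a, b) ⟨(le_max_left _ _).trans ha, (le_max_right _ _).trans hb'⟩)

lemma tendsto_conv {f ψ : ℕ → ℝ → ℝ} {f' ψ' : ℝ → ℝ} (hf : ∀ n, Continuous (f n))
    (hψ : ∀ n, Continuous (ψ n)) (hb : ∀ n t, 0 ≤ t → |f n t| ≤ 1) (hψb : ∀ n t, |ψ n t| ≤ 1)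
    (hlim : ∀ t, 0 ≤ t → Tendsto (fun n => f n t) atTop (𝓝 (f' t)))
    (hψlim : ∀ t, 0 ≤ t → Tendsto (fun n => ψ n t) atTop (𝓝 (ψ' t))) {t : ℝ} (ht : 0 ≤ t) :
    Tendsto (fun n => conv (f n) (ψ n) t) atTop (𝓝 (conv f' ψ' t)) := by
  refine intervalIntegral.tendsto_integral_filter_of_dominated_convergence (fun _ => 1)
      (Eventually.of_forall fun n => ?_) (Eventually.of_forall fun n =>
        Eventually.of_forall fun u hu => ?_) intervalIntegrable_const
      (Eventually.of_forall fun u hu => ?_)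
  · have := hf n
    have := hψ n
    exact Continuous.aestronglyMeasurable (by fun_prop)
  · rw [uIoc_of_le ht] at hu
    rw [Real.norm_eq_abs, abs_mul]
    exact mul_le_one₀ (hb n _ (by linarith [hu.2])) (abs_nonneg _) (hψb n u)
  · rw [uIoc_of_le ht] at hu
    exact (hlim _ (by linarith [hu.2])).mul (hψlim u hu.1.le)

end Volterra

/-! ### Infinitely many sites -/

section Limit

variable {α : ℝ} {x : ℕ → ℝ}

lemma abs_average_le_one {N : ℕ} {g : Fin (N + 1) → ℝ} (hg : ∀ i, 0 ≤ g i ∧ g i ≤ 1) :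
    |(∑ i, g i) / Fintype.card (Fin (N + 1))| ≤ 1 := by
  have hs : 0 ≤ ∑ i, g i := Finset.sum_nonneg fun i _ => (hg i).1
  have hn : (0 : ℝ) < Fintype.card (Fin (N + 1)) := by exact_mod_cast Fintype.card_pos
  rw [abs_of_nonneg (by positivity), div_le_one hn]
  calc ∑ i, g i ≤ ∑ _i : Fin (N + 1), (1 : ℝ) := Finset.sum_le_sum fun i _ => (hg i).2
    _ = _ := by simp

/-- As the number of sites tends to infinity, the expected jump rate converges to an antitone
function `ψ`, and the occupation probabilities converge to those that the limiting renewal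
equation yields. -/
theorem exists_limit_rate (hx : IsTypical α x) {p : ∀ N, Fin (N + 1) → ℝ → ℝ}
    (hp : ∀ N, IsTrapFlow (fun i : Fin (N + 1) => x i) (p N)) :
    ∃ ψ : ℝ → ℝ, Antitone ψ ∧ (∀ t, ψ t ∈ Icc (0 : ℝ) 1) ∧ ∀ δ t : ℝ, 0 ≤ t →
      Tendsto (fun N => ∑ i : Fin (N + 1), if δ < x i then p N i t else 0) atTop
        (𝓝 (meanTail α δ t + conv (meanTail α δ) ψ t)) := by
  have hx0 : ∀ i, 0 ≤ x i := fun i => (hx.mem_Ioo i).1.le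
  have hx1 : ∀ i, x i ≤ 1 := fun i => (hx.mem_Ioo i).2.le
  have havg : ∀ (g : ℝ → ℝ) (L : ℝ),
      Tendsto (fun n : ℕ => (∑ i ∈ Finset.range n, g (x i)) / n) atTop (𝓝 L) →
      Tendsto (fun N : ℕ => (∑ i : Fin (N + 1), g (x i)) / Fintype.card (Fin (N + 1))) atTop
        (𝓝 L) := by
    intro g L h
    refine ((tendsto_add_atTop_iff_nat 1).2 h).congr fun N => ?_
    rw [Finset.sum_range, Fintype.card_fin]
  set f : ℕ → ℝ → ℝ := fun N t =>
    (∑ i : Fin (N + 1), x i * Real.exp (-(x i * t))) / Fintype.card (Fin (N + 1)) with hf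
  set ψ : ℕ → ℝ → ℝ := fun N => jumpRate (fun i : Fin (N + 1) => x i) (p N) with hψ
  have hexp : ∀ i t, 0 ≤ t → Real.exp (-(x i * t)) ≤ 1 := fun i t ht =>
    Real.exp_le_one_iff.2 (neg_nonpos.2 (mul_nonneg (hx0 i) ht))
  have hfc : ∀ N, Continuous (f N) := fun N => by simp only [hf]; fun_prop
  have hψc : ∀ N, Continuous (ψ N) := fun N => (hp N).continuous_jumpRate
  have hfb : ∀ N t, 0 ≤ t → |f N t| ≤ 1 := fun N t ht => abs_average_le_one fun i =>
    ⟨mul_nonneg (hx0 i) (Real.exp_pos _).le,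
      mul_le_one₀ (hx1 i) (Real.exp_pos _).le (hexp i t ht)⟩
  have hψ0 : ∀ N t, 0 ≤ ψ N t := fun N t => (hp N).jumpRate_nonneg (fun i => hx0 i) t
  have hψ1 : ∀ N t, ψ N t ≤ 1 := fun N t => (hp N).jumpRate_le_one (fun i => hx1 i) t
  have hψb : ∀ N t, |ψ N t| ≤ 1 := fun N t => by
    rw [abs_of_nonneg (hψ0 N t)]; exact hψ1 N t
  have hren : ∀ N t, 0 ≤ t → ψ N t = f N t + conv (f N) (ψ N) t := fun N t ht =>
    (hp N).sum_mul_eq (fun i => x i) ht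
  have hflim : ∀ t, 0 ≤ t → Tendsto (fun N => f N t) atTop (𝓝 (meanRate α t)) := fun t _ =>
    havg (fun y => y * Real.exp (-(y * t))) _ (hx.tendsto_rate t)
  have hex : ∀ t, 0 ≤ t → ∃ L, Tendsto (fun N => ψ N t) atTop (𝓝 L) := fun t ht =>
    cauchySeq_tendsto_of_complete (cauchySeq_of_renewal hfc hψc hfb hψb hren hflim ht)
  choose! L hL using hex
  have hψlim : ∀ t, 0 ≤ t → Tendsto (fun N => ψ N t) atTop (𝓝 (L (max t 0))) := fun t ht => by
    rw [max_eq_left ht]; exact hL t ht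
  refine ⟨fun t => L (max t 0), fun s t hst => ?_, fun t => ?_, fun δ t ht => ?_⟩
  · refine le_of_tendsto_of_tendsto' (hL _ (le_max_right t 0)) (hL _ (le_max_right s 0))
      fun N => ?_
    exact (hp N).antitoneOn_jumpRate (le_max_right s 0) (le_max_right t 0)
      (max_le_max_right 0 hst)
  · exact isClosed_Icc.mem_of_tendsto (hL _ (le_max_right t 0))
      (Eventually.of_forall fun N => ⟨hψ0 N _, hψ1 N _⟩)
  · set A : ℕ → ℝ → ℝ := fun N t =>
      (∑ i : Fin (N + 1), (if δ < x i then 1 else 0) * Real.exp (-(x i * t))) /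
        Fintype.card (Fin (N + 1)) with hA
    have hAlim : ∀ t, 0 ≤ t → Tendsto (fun N => A N t) atTop (𝓝 (meanTail α δ t)) := fun t _ => by
      simpa only [tailKernel, hA, ite_mul, one_mul, zero_mul] using
        havg (tailKernel δ t) _ (hx.tendsto_tail δ t)
    have hAb : ∀ N t, 0 ≤ t → |A N t| ≤ 1 := fun N t ht => abs_average_le_one fun i => by
      split_ifs
      · rw [one_mul]
        exact ⟨(Real.exp_pos _).le, hexp i t ht⟩
      · simp
    have hAc : ∀ N, Continuous (A N) := fun N => by simp only [hA]; fun_prop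
    refine ((hAlim t ht).add (tendsto_conv hAc hψc hAb hψb hAlim hψlim ht)).congr fun N => ?_
    have h1 := (hp N).sum_mul_eq (fun i => if δ < x i then 1 else 0) ht
    simp only [ite_mul, one_mul, zero_mul] at h1
    rw [h1]
    simp only [hA, hψ, conv, ite_mul, one_mul, zero_mul]

end Limit

/-! ### The tail and its convolution with a power -/

section Stable

variable {α : ℝ}

lemma integrableOn_c (hα : 0 < α) :
    IntegrableOn (fun y : ℝ => y ^ (α - 1) * Real.exp (-y)) (Ioi 0) :=
  (Real.GammaIntegral_convergent hα).congr_fun (fun _ _ => mul_comm _ _) measurableSet_Ioi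

lemma c_pos (hα : 0 < α) : 0 < c α := by
  have : c α = Real.Gamma α := by
    rw [Real.Gamma_eq_integral hα, c]
    exact setIntegral_congr_fun measurableSet_Ioi fun y _ => mul_comm _ _
  rw [this]
  exact Real.Gamma_pos_of_pos hα

/-- In scaled form the tail is an incomplete Gamma integral, so that `t ^ α * meanTail α 0 t`
increases to `α * c α`. -/
lemma rpow_mul_meanTail (hα : 0 < α) {t : ℝ} (ht : 0 < t) :
    t ^ α * meanTail α 0 t = α * ∫ y in (0 : ℝ)..t, y ^ (α - 1) * Real.exp (-y) := by
  have h1 := intervalIntegral.mul_integral_comp_mul_left (a := 0) (b := 1) (c := t)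
    (f := fun y : ℝ => y ^ (α - 1) * Real.exp (-y))
  rw [mul_zero, mul_one] at h1
  rw [← h1, meanTail, integral_invLaw hα, intervalIntegral.integral_of_le zero_le_one,
    integral_Ioc_eq_integral_Ioo, ← integral_const_mul, ← integral_const_mul, ← integral_const_mul]
  refine setIntegral_congr_fun measurableSet_Ioo fun x hx => ?_
  have h2 : t ^ α = t * t ^ (α - 1) := by
    rw [← Real.rpow_one_add' ht.le (by linarith)]; ring_nf
  simp only [tailKernel, if_pos hx.1]
  rw [Real.mul_rpow ht.le hx.1.le, h2, mul_comm x t]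
  ring

lemma intervalIntegrable_c (hα : 0 < α) {a b : ℝ} (ha : 0 ≤ a) (hab : a ≤ b) :
    IntervalIntegrable (fun y : ℝ => y ^ (α - 1) * Real.exp (-y)) volume a b := by
  rw [intervalIntegrable_iff_integrableOn_Ioc_of_le hab]
  exact (integrableOn_c hα).mono_set fun y hy => ha.trans_lt hy.1

lemma meanTail_nonneg (δ t : ℝ) : 0 ≤ meanTail α δ t :=
  integral_nonneg fun _ => tailKernel_nonneg _ _ _

lemma monotoneOn_rpow_mul_meanTail (hα : 0 < α) :
    MonotoneOn (fun t => t ^ α * meanTail α 0 t) (Ici 0) := by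
  intro s hs t ht hst
  rw [mem_Ici] at hs ht
  rcases hs.eq_or_lt with rfl | hs'
  · simp only [Real.zero_rpow hα.ne', zero_mul]
    exact mul_nonneg (Real.rpow_nonneg ht _) (meanTail_nonneg _ _)
  simp only [rpow_mul_meanTail hα hs', rpow_mul_meanTail hα (hs'.trans_le hst)]
  refine mul_le_mul_of_nonneg_left ?_ hα.le
  refine intervalIntegral.integral_mono_interval le_rfl hs hst ?_
    (intervalIntegrable_c hα le_rfl ht)
  filter_upwards [ae_restrict_mem measurableSet_Ioc] with y hy
  exact mul_nonneg (Real.rpow_nonneg hy.1.le _) (Real.exp_pos _).le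

lemma tendsto_rpow_mul_meanTail (hα : 0 < α) :
    Tendsto (fun t => t ^ α * meanTail α 0 t) atTop (𝓝 (α * c α)) := by
  have h1 := (intervalIntegral_tendsto_integral_Ioi 0 (integrableOn_c hα) tendsto_id).const_mul α
  refine h1.congr' ?_
  filter_upwards [eventually_gt_atTop 0] with t ht
  exact (rpow_mul_meanTail hα ht).symm

lemma rpow_mul_meanTail_le (hα : 0 < α) {t : ℝ} (ht : 0 ≤ t) :
    t ^ α * meanTail α 0 t ≤ α * c α := by
  refine ge_of_tendsto (tendsto_rpow_mul_meanTail hα) ?_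
  filter_upwards [eventually_ge_atTop t] with u hu
  exact monotoneOn_rpow_mul_meanTail hα ht (mem_Ici.2 (ht.trans hu)) hu

lemma integrableOn_div_one_add (hα0 : 0 < α) (hα1 : α < 1) :
    IntegrableOn (fun y : ℝ => y ^ (α - 1) / (1 + y)) (Ioi 0) := by
  have hmeas : Measurable fun y : ℝ => y ^ (α - 1) / (1 + y) := by fun_prop
  rw [← Ioc_union_Ioi_eq_Ioi zero_le_one]
  refine IntegrableOn.union ?_ ?_
  · have h1 : IntegrableOn (fun y : ℝ => y ^ (α - 1)) (Ioc 0 1) :=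
      (intervalIntegrable_iff_integrableOn_Ioc_of_le zero_le_one).1
        (intervalIntegral.intervalIntegrable_rpow' (by linarith))
    refine Integrable.mono' h1 hmeas.aestronglyMeasurable ?_
    filter_upwards [ae_restrict_mem measurableSet_Ioc] with y hy
    have hp := Real.rpow_nonneg hy.1.le (α - 1)
    rw [Real.norm_of_nonneg (div_nonneg hp (by linarith [hy.1]))]
    exact div_le_self hp (by linarith [hy.1])
  · refine Integrable.mono' (integrableOn_Ioi_rpow_of_lt (a := α - 2) (by linarith) zero_lt_one)
      hmeas.aestronglyMeasurable ?_
    filter_upwards [ae_restrict_mem measurableSet_Ioi] with y hy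
    have hy0 : (0 : ℝ) < y := zero_lt_one.trans hy
    have hp := Real.rpow_nonneg hy0.le (α - 1)
    rw [Real.norm_of_nonneg (div_nonneg hp (by linarith : (0 : ℝ) ≤ 1 + y)),
      show y ^ (α - 2) = y ^ (α - 1) / y by rw [← Real.rpow_sub_one hy0.ne']; ring_nf]
    exact div_le_div_of_nonneg_left hp hy0 (by linarith : y ≤ 1 + y)

lemma image_one_div_one_add : (fun y : ℝ => 1 / (1 + y)) '' Ioi 0 = Ioo 0 1 := by
  ext w
  constructor
  · rintro ⟨y, hy, rfl⟩
    rw [mem_Ioi] at hy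
    exact ⟨by positivity, by rw [div_lt_one (by linarith)]; linarith⟩
  · intro hw
    refine ⟨1 / w - 1, ?_, by simp⟩
    have := (one_lt_div hw.1).2 hw.2
    exact sub_pos.2 this

lemma beta_density_comp {y : ℝ} (hy : 0 < y) :
    |-(1 : ℝ) / (1 + y) ^ 2| • ((1 - 1 / (1 + y)) ^ (α - 1) * (1 / (1 + y)) ^ (-α))
      = y ^ (α - 1) / (1 + y) := by
  have h1 : (0 : ℝ) < 1 + y := by linarith
  have h2 : 1 - 1 / (1 + y) = y / (1 + y) := by field_simp; ring
  rw [h2, Real.div_rpow hy.le h1.le, Real.div_rpow zero_le_one h1.le, Real.one_rpow,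
    Real.rpow_neg h1.le, Real.rpow_sub_one h1.ne', abs_div, abs_neg, abs_one,
    abs_of_pos (by positivity), smul_eq_mul]
  have h3 : (1 + y) ^ α ≠ 0 := (Real.rpow_pos_of_pos h1 _).ne'
  field_simp

lemma hasDerivWithinAt_one_div_one_add {y : ℝ} (hy : y ∈ Ioi (0 : ℝ)) :
    HasDerivWithinAt (fun y : ℝ => 1 / (1 + y)) (-(1 : ℝ) / (1 + y) ^ 2) (Ioi 0) y := by
  rw [mem_Ioi] at hy
  have := ((hasDerivAt_id y).const_add 1).fun_inv (by simp; linarith)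
  simpa [one_div] using this.hasDerivWithinAt

lemma injOn_one_div_one_add : InjOn (fun y : ℝ => 1 / (1 + y)) (Ioi 0) := by
  intro y _ z _ h
  simpa using h

/-- The substitution `w = 1 / (1 + y)` turns the denominator of `B α δ` into a Beta integral. -/
lemma integral_beta :
    ∫ w in (0 : ℝ)..1, (1 - w) ^ (α - 1) * w ^ (-α)
      = ∫ y in Ioi (0 : ℝ), y ^ (α - 1) / (1 + y) := by
  rw [intervalIntegral.integral_of_le zero_le_one, integral_Ioc_eq_integral_Ioo,
    ← image_one_div_one_add, integral_image_eq_integral_abs_deriv_smul measurableSet_Ioi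
      (fun y hy => hasDerivWithinAt_one_div_one_add hy) injOn_one_div_one_add]
  exact setIntegral_congr_fun measurableSet_Ioi fun y hy => beta_density_comp hy

lemma intervalIntegrable_beta (hα0 : 0 < α) (hα1 : α < 1) :
    IntervalIntegrable (fun w : ℝ => (1 - w) ^ (α - 1) * w ^ (-α)) volume 0 1 := by
  rw [intervalIntegrable_iff_integrableOn_Ioo_of_le zero_le_one, ← image_one_div_one_add,
    integrableOn_image_iff_integrableOn_abs_deriv_smul measurableSet_Ioi
      (fun y hy => hasDerivWithinAt_one_div_one_add hy) injOn_one_div_one_add]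
  exact (integrableOn_div_one_add hα0 hα1).congr_fun
    (fun y hy => (beta_density_comp hy).symm) measurableSet_Ioi

lemma integral_div_one_add_pos (hα0 : 0 < α) (hα1 : α < 1) :
    0 < ∫ y in Ioi (0 : ℝ), y ^ (α - 1) / (1 + y) := by
  have hpos : ∀ y ∈ Ioi (0 : ℝ), 0 < y ^ (α - 1) / (1 + y) := fun y hy =>
    div_pos (Real.rpow_pos_of_pos hy _) (by linarith [mem_Ioi.1 hy])
  rw [setIntegral_pos_iff_support_of_nonneg_ae
    (by filter_upwards [ae_restrict_mem measurableSet_Ioi] with y hy using (hpos y hy).le)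
    (integrableOn_div_one_add hα0 hα1)]
  have : Ioi (0 : ℝ) ⊆ Function.support (fun y : ℝ => y ^ (α - 1) / (1 + y)) ∩ Ioi 0 :=
    fun y hy => ⟨(hpos y hy).ne', hy⟩
  exact lt_of_lt_of_le (by simp) (measure_mono this)

/-- The limit `κ` of the convolution of `t ^ (α - 1)` with `meanTail α 0`. -/
noncomputable def kappa (α : ℝ) : ℝ := α * c α * ∫ y in Ioi (0 : ℝ), y ^ (α - 1) / (1 + y)

lemma kappa_pos (hα0 : 0 < α) (hα1 : α < 1) : 0 < kappa α :=
  mul_pos (mul_pos hα0 (c_pos hα0)) (integral_div_one_add_pos hα0 hα1)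

/-- The convolution of `t ^ (α - 1)` with `meanTail α 0`. -/
noncomputable def smoothTail (α : ℝ) : ℝ → ℝ := conv (fun u => u ^ (α - 1)) (meanTail α 0)

/-- The scaling form of `smoothTail`. -/
lemma smoothTail_eq (hα : 0 < α) {r : ℝ} (hr : 0 ≤ r) :
    smoothTail α r = ∫ w in (0 : ℝ)..1,
      (1 - w) ^ (α - 1) * w ^ (-α) * ((r * w) ^ α * meanTail α 0 (r * w)) := by
  rcases hr.eq_or_lt with rfl | hr
  · simp [smoothTail, conv, Real.zero_rpow hα.ne']
  have h1 := intervalIntegral.mul_integral_comp_mul_left (a := 0) (b := 1) (c := r)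
    (f := fun v : ℝ => (r - v) ^ (α - 1) * meanTail α 0 v)
  rw [mul_zero, mul_one] at h1
  rw [smoothTail, conv, ← h1, ← intervalIntegral.integral_const_mul,
    intervalIntegral.integral_of_le zero_le_one, intervalIntegral.integral_of_le zero_le_one,
    integral_Ioc_eq_integral_Ioo, integral_Ioc_eq_integral_Ioo]
  refine setIntegral_congr_fun measurableSet_Ioo fun w hw => ?_
  have h2 : r - r * w = r * (1 - w) := by ring
  have h3 : r * r ^ (α - 1) = r ^ α := by
    rw [Real.rpow_sub_one hr.ne']; field_simp
  have h4 : w ^ (-α) * w ^ α = 1 := by rw [← Real.rpow_add hw.1]; simp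
  rw [h2, Real.mul_rpow hr.le (by linarith [hw.2]), Real.mul_rpow hr.le hw.1.le, ← h3]
  linear_combination (-(r * r ^ (α - 1) * (1 - w) ^ (α - 1) * meanTail α 0 (r * w))) * h4

lemma intervalIntegrable_smoothTail (hα0 : 0 < α) (hα1 : α < 1) (r : ℝ) :
    IntervalIntegrable (fun w : ℝ => (1 - w) ^ (α - 1) * w ^ (-α) *
      ((r * w) ^ α * meanTail α 0 (r * w))) volume 0 1 := by
  have h := continuous_meanTail hα0 0
  refine (intervalIntegrable_beta hα0 hα1).mul_continuousOn (Continuous.continuousOn ?_)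
  exact ((by fun_prop : Continuous fun w : ℝ => r * w).rpow_const fun _ => Or.inr hα0.le).mul
    (h.comp (by fun_prop))

lemma beta_density_nonneg {w : ℝ} (hw : w ∈ Icc (0 : ℝ) 1) :
    0 ≤ (1 - w) ^ (α - 1) * w ^ (-α) :=
  mul_nonneg (Real.rpow_nonneg (by linarith [hw.2]) _) (Real.rpow_nonneg hw.1 _)

lemma monotoneOn_smoothTail (hα0 : 0 < α) (hα1 : α < 1) :
    MonotoneOn (smoothTail α) (Ici 0) := by
  intro r hr s hs hrs
  rw [mem_Ici] at hr hs
  rw [smoothTail_eq hα0 hr, smoothTail_eq hα0 hs]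
  refine intervalIntegral.integral_mono_on zero_le_one (intervalIntegrable_smoothTail hα0 hα1 r)
    (intervalIntegrable_smoothTail hα0 hα1 s) fun w hw => ?_
  exact mul_le_mul_of_nonneg_left (monotoneOn_rpow_mul_meanTail hα0 (mul_nonneg hr hw.1)
    (mul_nonneg hs hw.1) (mul_le_mul_of_nonneg_right hrs hw.1)) (beta_density_nonneg hw)

lemma kappa_eq_integral : kappa α = ∫ w in (0 : ℝ)..1,
    (1 - w) ^ (α - 1) * w ^ (-α) * (α * c α) := by
  rw [intervalIntegral.integral_mul_const, integral_beta, kappa, mul_comm]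

lemma tendsto_smoothTail (hα0 : 0 < α) (hα1 : α < 1) :
    Tendsto (smoothTail α) atTop (𝓝 (kappa α)) := by
  have h : Tendsto (fun r : ℝ => ∫ w in (0 : ℝ)..1,
      (1 - w) ^ (α - 1) * w ^ (-α) * ((r * w) ^ α * meanTail α 0 (r * w))) atTop
      (𝓝 (kappa α)) := by
    rw [kappa_eq_integral]
    refine intervalIntegral.tendsto_integral_filter_of_dominated_convergence
      (fun w => (1 - w) ^ (α - 1) * w ^ (-α) * (α * c α)) (Eventually.of_forall fun r => ?_) ?_
      ((intervalIntegrable_beta hα0 hα1).mul_const _)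
      (Eventually.of_forall fun w hw => ?_)
    · have := (intervalIntegrable_smoothTail hα0 hα1 r).aestronglyMeasurable
      rwa [uIoc_of_le zero_le_one]
    · filter_upwards [eventually_ge_atTop 0] with r hr
      refine Eventually.of_forall fun w hw => ?_
      rw [uIoc_of_le zero_le_one] at hw
      have hb := beta_density_nonneg (α := α) ⟨hw.1.le, hw.2⟩
      have hrw : 0 ≤ r * w := mul_nonneg hr hw.1.le
      rw [Real.norm_of_nonneg (mul_nonneg hb
        (mul_nonneg (Real.rpow_nonneg hrw _) (meanTail_nonneg _ _)))]
      exact mul_le_mul_of_nonneg_left (rpow_mul_meanTail_le hα0 hrw) hb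
    · rw [uIoc_of_le zero_le_one] at hw
      exact ((tendsto_rpow_mul_meanTail hα0).comp
        (tendsto_id.atTop_mul_const hw.1)).const_mul _
  refine h.congr' ?_
  filter_upwards [eventually_ge_atTop 0] with r hr
  exact (smoothTail_eq hα0 hr).symm

lemma smoothTail_nonneg (hα0 : 0 < α) (hα1 : α < 1) {r : ℝ} (hr : 0 ≤ r) :
    0 ≤ smoothTail α r := by
  have := monotoneOn_smoothTail hα0 hα1 self_mem_Ici hr hr
  rwa [smoothTail, conv, intervalIntegral.integral_same] at this

lemma smoothTail_le (hα0 : 0 < α) (hα1 : α < 1) {r : ℝ} (hr : 0 ≤ r) :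
    smoothTail α r ≤ kappa α := by
  refine ge_of_tendsto (tendsto_smoothTail hα0 hα1) ?_
  filter_upwards [eventually_ge_atTop r] with u hu
  exact monotoneOn_smoothTail hα0 hα1 hr (mem_Ici.2 (hr.trans hu)) hu

end Stable

/-! ### Asymptotics of the jump rate -/

section RenewalAsymptotics

/-- Associativity of the convolution on `[0, ∞)`. -/
lemma conv_assoc {a G ψ : ℝ → ℝ} {t : ℝ} (ht : 0 ≤ t) (ha : Measurable a)
    (hai : IntervalIntegrable a volume 0 t) (hG : Measurable G) (hψ : Measurable ψ)
    (hGb : ∀ t, 0 ≤ t → |G t| ≤ 1) (hψb : ∀ t, |ψ t| ≤ 1) :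
    conv a (conv G ψ) t = conv (conv a G) ψ t := by
  set Φ : ℝ → ℝ → ℝ := fun s u => if u ≤ s then a (t - s) * (G (s - u) * ψ u) else 0 with hΦ
  have hai' : Integrable (fun s => a (t - s)) (volume.restrict (Ioc 0 t)) := by
    have h := hai.comp_sub_left t
    simp only [sub_zero, sub_self] at h
    exact (intervalIntegrable_iff_integrableOn_Ioc_of_le ht).1 h.symm
  have hΦi : Integrable (Function.uncurry Φ)
      ((volume.restrict (Ioc 0 t)).prod (volume.restrict (Ioc 0 t))) := by
    refine Integrable.mono' (hai'.norm.comp_fst (volume.restrict (Ioc 0 t))) ?_ ?_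
    · refine Measurable.aestronglyMeasurable ?_
      refine Measurable.ite (measurableSet_le measurable_snd measurable_fst) ?_ measurable_const
      fun_prop
    · refine Eventually.of_forall fun ⟨s, u⟩ => ?_
      simp only [Function.uncurry_apply_pair, hΦ]
      split_ifs with h
      · rw [norm_mul]
        refine mul_le_of_le_one_right (norm_nonneg _) ?_
        rw [Real.norm_eq_abs, abs_mul]
        exact mul_le_one₀ (hGb _ (sub_nonneg.2 h)) (abs_nonneg _) (hψb u)
      · simp
  have hL : conv a (conv G ψ) t = ∫ s in Ioc 0 t, ∫ u in Ioc 0 t, Φ s u := by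
    rw [conv, intervalIntegral.integral_of_le ht]
    refine setIntegral_congr_fun measurableSet_Ioc fun s hs => ?_
    simp only [conv]
    rw [intervalIntegral.integral_of_le hs.1.le, ← integral_const_mul]
    have h1 : ∀ u, Φ s u = (Iic s).indicator (fun u => a (t - s) * (G (s - u) * ψ u)) u :=
      fun u => by simp only [hΦ, indicator_apply, mem_Iic]
    simp_rw [h1]
    rw [setIntegral_indicator measurableSet_Iic]
    congr 2
    ext u
    simp only [mem_Ioc, mem_inter_iff, mem_Iic]
    exact ⟨fun h => ⟨⟨h.1, h.2.trans hs.2⟩, h.2⟩, fun h => ⟨h.1.1, h.2⟩⟩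
  have hR : conv (conv a G) ψ t = ∫ u in Ioc 0 t, ∫ s in Ioc 0 t, Φ s u := by
    rw [conv, intervalIntegral.integral_of_le ht]
    refine setIntegral_congr_fun measurableSet_Ioc fun u hu => ?_
    have h2 := intervalIntegral.integral_comp_sub_right (a := u) (b := t)
      (fun v => a (t - u - v) * G v) u
    rw [sub_self] at h2
    simp only [conv]
    rw [← h2, ← intervalIntegral.integral_mul_const, intervalIntegral.integral_of_le hu.2,
      ← integral_Icc_eq_integral_Ioc]
    have h1 : ∀ s, Φ s u = (Ici u).indicator (fun s => a (t - s) * (G (s - u) * ψ u)) s :=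
      fun s => by simp only [hΦ, indicator_apply, mem_Ici]
    simp_rw [h1]
    rw [setIntegral_indicator measurableSet_Ici]
    have h3 : Ioc 0 t ∩ Ici u = Icc u t := by
      ext s
      simp only [mem_Ioc, mem_inter_iff, mem_Ici, mem_Icc]
      exact ⟨fun h => ⟨h.2, h.1.2⟩, fun h => ⟨⟨hu.1.trans_le h.1, h.2⟩, h.1⟩⟩
    rw [h3]
    refine setIntegral_congr_fun measurableSet_Icc fun s _ => ?_
    have : t - u - (s - u) = t - s := by ring
    simp only [this]
    ring
  rw [hL, hR]
  exact integral_integral_swap hΦi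

/-- A monotone density theorem: if the integral of an antitone function is asymptotic to
`D * t ^ α`, the function is asymptotic to its derivative. -/
lemma tendsto_of_tendsto_integral {α D : ℝ} {ψ : ℝ → ℝ} (hψ : Antitone ψ)
    (h : Tendsto (fun t => (∫ u in (0 : ℝ)..t, ψ u) / t ^ α) atTop (𝓝 D)) :
    Tendsto (fun t => t ^ (1 - α) * ψ t) atTop (𝓝 (D * α)) := by
  set Ψ : ℝ → ℝ := fun t => ∫ u in (0 : ℝ)..t, ψ u with hΨ
  have hi : ∀ a b, IntervalIntegrable ψ volume a b := fun a b => hψ.intervalIntegrable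
  -- `q l` compares `ψ t` with the mean of `ψ` between `t` and `l * t`.
  set q : ℝ → ℝ → ℝ := fun l t => (l ^ α * (Ψ (l * t) / (l * t) ^ α) - Ψ t / t ^ α) / (l - 1)
    with hq
  have hqlim : ∀ l, 0 < l → Tendsto (q l) atTop (𝓝 (D * ((l ^ α - 1) / (l - 1)))) := by
    intro l hl
    have h1 := h.comp (tendsto_id.const_mul_atTop hl)
    have h2 := ((h1.const_mul (l ^ α)).sub h).div_const (l - 1)
    refine (h2.congr fun t => ?_).trans (le_of_eq ?_)
    · simp [hq, hΨ]
    · congr 1; ring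
  have hqeq : ∀ l t, 0 < l → 0 < t → q l t = (Ψ (l * t) - Ψ t) / (l - 1) / t ^ α := by
    intro l t hl ht
    have h1 := (Real.rpow_pos_of_pos hl α).ne'
    have h2 := (Real.rpow_pos_of_pos ht α).ne'
    simp only [hq]
    rw [Real.mul_rpow hl.le ht.le]
    field_simp
  have hdiff : ∀ a b, Ψ b - Ψ a = ∫ u in a..b, ψ u := fun a b => by
    simp only [hΨ]
    rw [← intervalIntegral.integral_interval_sub_left (hi 0 b) (hi 0 a)]
  have hscale : ∀ t, 0 < t → t ^ (1 - α) * ψ t = t * ψ t / t ^ α := by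
    intro t ht
    rw [Real.rpow_sub ht, Real.rpow_one]; ring
  have hlow : ∀ l t, 1 < l → 0 < t → q l t ≤ t ^ (1 - α) * ψ t := by
    intro l t hl ht
    rw [hqeq l t (by linarith) ht, hscale t ht]
    refine div_le_div_of_nonneg_right ?_ (Real.rpow_nonneg ht.le _)
    rw [div_le_iff₀ (by linarith), hdiff]
    have h1 : t ≤ l * t := by nlinarith
    have h2 := intervalIntegral.integral_mono_on h1 (hi _ _)
      (intervalIntegrable_const (c := ψ t)) fun u hu => hψ hu.1
    rw [intervalIntegral.integral_const, smul_eq_mul] at h2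
    nlinarith
  have hup : ∀ l t, 0 < l → l < 1 → 0 < t → t ^ (1 - α) * ψ t ≤ q l t := by
    intro l t hl hl1 ht
    rw [hqeq l t hl ht, hscale t ht]
    refine div_le_div_of_nonneg_right ?_ (Real.rpow_nonneg ht.le _)
    have h1 : l * t ≤ t := by nlinarith
    rw [← neg_div_neg_eq, le_div_iff₀ (by linarith), neg_sub, neg_sub, hdiff]
    have h2 := intervalIntegral.integral_mono_on h1
      (intervalIntegrable_const (c := ψ t)) (hi _ _) fun u hu => hψ hu.2
    rw [intervalIntegral.integral_const, smul_eq_mul] at h2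
    nlinarith
  have hslope : Tendsto (fun l : ℝ => D * ((l ^ α - 1) / (l - 1))) (𝓝[≠] 1) (𝓝 (D * α)) := by
    have h1 : HasDerivAt (fun l : ℝ => l ^ α) (α * 1 ^ (α - 1)) 1 :=
      Real.hasDerivAt_rpow_const (Or.inl one_ne_zero)
    rw [hasDerivAt_iff_tendsto_slope, Real.one_rpow, mul_one] at h1
    refine (h1.congr fun l => ?_).const_mul D
    rw [slope_def_field, Real.one_rpow]
  refine tendsto_order.2 ⟨fun a ha => ?_, fun a ha => ?_⟩
  · have h1 : ∀ᶠ l in 𝓝[>] (1 : ℝ), a < D * ((l ^ α - 1) / (l - 1)) :=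
      (hslope.mono_left (nhdsWithin_mono 1 fun l hl => ne_of_gt hl)).eventually (lt_mem_nhds ha)
    obtain ⟨l, hl, hl1⟩ := (h1.and self_mem_nhdsWithin).exists
    filter_upwards [(hqlim l (by linarith)).eventually (lt_mem_nhds hl), eventually_gt_atTop 0]
      with t ht1 ht
    exact ht1.trans_le (hlow l t hl1 ht)
  · have h1 : ∀ᶠ l in 𝓝[<] (1 : ℝ), D * ((l ^ α - 1) / (l - 1)) < a :=
      (hslope.mono_left (nhdsWithin_mono 1 fun l hl => ne_of_lt hl)).eventually (gt_mem_nhds ha)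
    obtain ⟨l, hl, hl1⟩ := (h1.and (Ioo_mem_nhdsLT (zero_lt_one (α := ℝ)))).exists
    filter_upwards [(hqlim l hl1.1).eventually (gt_mem_nhds hl), eventually_gt_atTop 0]
      with t ht1 ht
    exact (hup l t hl1.1 hl1.2 ht).trans_lt ht1

variable {α : ℝ}

lemma meanTail_le_exp (hα : 0 < α) {δ t : ℝ} (ht : 0 ≤ t) :
    meanTail α δ t ≤ Real.exp (-(δ * t)) := by
  have := isProbabilityMeasure_invLaw hα
  have h1 : meanTail α δ t ≤ ∫ _x, Real.exp (-(δ * t)) ∂invLaw α := by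
    refine integral_mono_of_nonneg (Eventually.of_forall fun _ => tailKernel_nonneg _ _ _)
      (integrable_const _) (Eventually.of_forall fun x => ?_)
    simp only [tailKernel]
    split_ifs with h
    · exact Real.exp_le_exp.2 (neg_le_neg (mul_le_mul_of_nonneg_right h.le ht))
    · positivity
  simpa using h1

lemma abs_meanTail_zero_le (hα : 0 < α) {t : ℝ} (ht : 0 ≤ t) : |meanTail α 0 t| ≤ 1 := by
  rw [abs_of_nonneg (meanTail_nonneg _ _)]
  simpa using meanTail_le_exp hα (δ := 0) ht

/-- The renewal equation after convolution with `t ^ (α - 1)`. -/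
lemma conv_smoothTail (hα0 : 0 < α) {ψ : ℝ → ℝ} (hψ : Antitone ψ)
    (hψb : ∀ t, ψ t ∈ Icc (0 : ℝ) 1)
    (hren : ∀ t, 0 ≤ t → meanTail α 0 t + conv (meanTail α 0) ψ t = 1) {t : ℝ} (ht : 0 ≤ t) :
    conv (smoothTail α) ψ t = t ^ α / α - smoothTail α t := by
  have hG := continuous_meanTail hα0 0
  have hai : IntervalIntegrable (fun u : ℝ => u ^ (α - 1)) volume 0 t :=
    intervalIntegral.intervalIntegrable_rpow' (by linarith)
  have hai' : IntervalIntegrable (fun u : ℝ => (t - u) ^ (α - 1)) volume 0 t := by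
    have h := hai.comp_sub_left t
    simp only [sub_zero, sub_self] at h
    exact h.symm
  rw [smoothTail, ← conv_assoc ht (by fun_prop) hai hG.measurable hψ.measurable
    (fun t ht => abs_meanTail_zero_le hα0 ht)
    (fun t => abs_le.2 ⟨by linarith [(hψb t).1], (hψb t).2⟩)]
  have h1 : conv (fun u => u ^ (α - 1)) (conv (meanTail α 0) ψ) t
      = ∫ u in (0 : ℝ)..t, ((t - u) ^ (α - 1) - (t - u) ^ (α - 1) * meanTail α 0 u) := by
    refine intervalIntegral.integral_congr fun u hu => ?_
    rw [uIcc_of_le ht] at hu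
    have := hren u hu.1
    rw [← eq_sub_iff_add_eq'] at this
    simp only [this]
    ring
  rw [h1, intervalIntegral.integral_sub hai' (hai'.mul_continuousOn hG.continuousOn),
    intervalIntegral.integral_comp_sub_left (fun u => u ^ (α - 1)) t, sub_self, sub_zero,
    integral_rpow (Or.inl (by linarith)), sub_add_cancel, Real.zero_rpow hα0.ne', sub_zero]
  rfl

lemma tendsto_integral_rate (hα0 : 0 < α) (hα1 : α < 1) {ψ : ℝ → ℝ} (hψ : Antitone ψ)
    (hψb : ∀ t, ψ t ∈ Icc (0 : ℝ) 1)
    (hren : ∀ t, 0 ≤ t → meanTail α 0 t + conv (meanTail α 0) ψ t = 1) :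
    Tendsto (fun t => (∫ u in (0 : ℝ)..t, ψ u) / t ^ α) atTop (𝓝 (1 / (α * kappa α))) := by
  have hκ := kappa_pos hα0 hα1
  set Ψ : ℝ → ℝ := fun t => ∫ u in (0 : ℝ)..t, ψ u with hΨ
  have hi : ∀ a b, IntervalIntegrable ψ volume a b := fun a b => hψ.intervalIntegrable
  have hKi : ∀ t, 0 ≤ t → ∀ s ∈ Icc 0 t,
      IntervalIntegrable (fun u => smoothTail α (t - u) * ψ u) volume 0 s := by
    intro t ht s hs
    refine AntitoneOn.intervalIntegrable ?_
    rw [uIcc_of_le hs.1]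
    intro u hu v hv huv
    have h1 : 0 ≤ t - v := by linarith [hv.2, hs.2]
    have h2 : 0 ≤ t - u := by linarith
    exact mul_le_mul (monotoneOn_smoothTail hα0 hα1 h1 h2 (by linarith)) (hψ huv) (hψb v).1
      (smoothTail_nonneg hα0 hα1 h2)
  have hpow : Tendsto (fun t : ℝ => t ^ α) atTop atTop := tendsto_rpow_atTop hα0
  have hlow : ∀ t, 0 ≤ t → t ^ α / α - kappa α ≤ kappa α * Ψ t := by
    intro t ht
    have h1 := conv_smoothTail hα0 hψ hψb hren ht
    have h2 : conv (smoothTail α) ψ t ≤ ∫ u in (0 : ℝ)..t, kappa α * ψ u := by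
      refine intervalIntegral.integral_mono_on ht (hKi t ht t ⟨ht, le_rfl⟩)
        ((hi 0 t).const_mul _) fun u hu => ?_
      exact mul_le_mul_of_nonneg_right (smoothTail_le hα0 hα1 (by linarith [hu.2])) (hψb u).1
    rw [intervalIntegral.integral_const_mul] at h2
    linarith [smoothTail_le hα0 hα1 ht]
  have hup : ∀ m M, 0 ≤ m → 0 ≤ M → (∀ r, M ≤ r → m ≤ smoothTail α r) → ∀ t, M ≤ t →
      m * Ψ t ≤ t ^ α / α + m * M := by
    intro m M hm hM hmK t ht
    have ht0 : 0 ≤ t := hM.trans ht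
    have hs : t - M ∈ Icc 0 t := ⟨by linarith, by linarith⟩
    have h1 := conv_smoothTail hα0 hψ hψb hren ht0
    have h2 : ∫ u in (0 : ℝ)..(t - M), m * ψ u
        ≤ ∫ u in (0 : ℝ)..(t - M), smoothTail α (t - u) * ψ u := by
      refine intervalIntegral.integral_mono_on hs.1 ((hi _ _).const_mul _)
        (hKi t ht0 _ hs) fun u hu => ?_
      exact mul_le_mul_of_nonneg_right (hmK _ (by linarith [hu.2])) (hψb u).1
    have h3 : ∫ u in (0 : ℝ)..(t - M), smoothTail α (t - u) * ψ u
        ≤ conv (smoothTail α) ψ t := by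
      refine intervalIntegral.integral_mono_interval le_rfl hs.1 hs.2 ?_
        (hKi t ht0 t ⟨ht0, le_rfl⟩)
      filter_upwards [ae_restrict_mem measurableSet_Ioc] with u hu
      exact mul_nonneg (smoothTail_nonneg hα0 hα1 (by linarith [hu.2])) (hψb u).1
    have h4 : Ψ t - Ψ (t - M) ≤ M := by
      have h5 : Ψ t - Ψ (t - M) = ∫ u in (t - M)..t, ψ u :=
        intervalIntegral.integral_interval_sub_left (hi 0 t) (hi 0 (t - M))
      have h6 := intervalIntegral.integral_mono_on hs.2 (hi (t - M) t)
        (intervalIntegrable_const (c := (1 : ℝ))) fun u _ => (hψb u).2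
      rw [intervalIntegral.integral_const, smul_eq_mul] at h6
      linarith
    rw [intervalIntegral.integral_const_mul] at h2
    have h7 := smoothTail_nonneg hα0 hα1 ht0
    change m * Ψ (t - M) ≤ _ at h2
    nlinarith
  refine tendsto_order.2 ⟨fun a ha => ?_, fun a ha => ?_⟩
  · have h1 : Tendsto (fun t : ℝ => (1 / α - kappa α / t ^ α) / kappa α) atTop
        (𝓝 ((1 / α - 0) / kappa α)) :=
      ((tendsto_const_nhds.div_atTop hpow).const_sub _).div_const _
    rw [sub_zero, div_div] at h1
    filter_upwards [h1.eventually (lt_mem_nhds ha), eventually_gt_atTop 0] with t ht1 ht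
    refine ht1.trans_le ?_
    have hp := Real.rpow_pos_of_pos ht α
    rw [div_le_div_iff₀ hκ hp]
    have := hlow t ht.le
    calc (1 / α - kappa α / t ^ α) * t ^ α = t ^ α / α - kappa α := by field_simp
      _ ≤ kappa α * Ψ t := this
      _ = _ := mul_comm _ _
  · -- Choose `m < κ` so close to `κ` that `1 / (α * m) < a`.
    have h0 : Tendsto (fun m : ℝ => 1 / (α * m)) (𝓝[<] kappa α) (𝓝 (1 / (α * kappa α))) := by
      have : ContinuousAt (fun m : ℝ => 1 / (α * m)) (kappa α) :=
        ContinuousAt.div (by fun_prop) (by fun_prop) (mul_pos hα0 hκ).ne'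
      exact this.tendsto.mono_left nhdsWithin_le_nhds
    obtain ⟨m, hm, hm0, hmκ⟩ :=
      ((h0.eventually (gt_mem_nhds ha)).and (Ioo_mem_nhdsLT hκ)).exists
    obtain ⟨M, hM⟩ := eventually_atTop.1
      ((tendsto_smoothTail hα0 hα1).eventually (lt_mem_nhds hmκ))
    have h1 : Tendsto (fun t : ℝ => (1 / α + m * max M 0 / t ^ α) / m) atTop
        (𝓝 ((1 / α + 0) / m)) :=
      ((tendsto_const_nhds.div_atTop hpow).const_add _).div_const _
    rw [add_zero, div_div] at h1
    filter_upwards [h1.eventually (gt_mem_nhds hm), eventually_gt_atTop 0,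
      eventually_ge_atTop (max M 0)] with t ht1 ht htM
    refine lt_of_le_of_lt ?_ ht1
    have hp := Real.rpow_pos_of_pos ht α
    rw [div_le_div_iff₀ hp hm0]
    have := hup m (max M 0) hm0.le (le_max_right _ _)
      (fun r hr => (hM r ((le_max_left _ _).trans hr)).le) t htM
    calc Ψ t * m = m * Ψ t := mul_comm _ _
      _ ≤ t ^ α / α + m * max M 0 := this
      _ = _ := by field_simp

/-- The strong renewal theorem for the limiting jump rate. -/
theorem tendsto_rate (hα0 : 0 < α) (hα1 : α < 1) {ψ : ℝ → ℝ} (hψ : Antitone ψ)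
    (hψb : ∀ t, ψ t ∈ Icc (0 : ℝ) 1)
    (hren : ∀ t, 0 ≤ t → meanTail α 0 t + conv (meanTail α 0) ψ t = 1) :
    Tendsto (fun t => t ^ (1 - α) * ψ t) atTop (𝓝 (1 / kappa α)) := by
  have h := tendsto_of_tendsto_integral hψ (tendsto_integral_rate hα0 hα1 hψ hψb hren)
  have hκ := kappa_pos hα0 hα1
  convert h using 2
  field_simp

end RenewalAsymptotics

/-! ### States with a short waiting time -/

section Tail

variable {α : ℝ}

/-- Convolving a function asymptotic to `ℓ * t ^ (α - 1)` with an exponentially small `A`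
multiplies the asymptotics by the integral of `A`. -/
lemma tendsto_rpow_mul_conv (hα0 : 0 < α) (hα1 : α < 1) {A ψ : ℝ → ℝ} {δ ℓ : ℝ} (hδ : 0 < δ)
    (hA : Measurable A) (hAb : ∀ t, 0 ≤ t → |A t| ≤ Real.exp (-(δ * t))) (hψ : Antitone ψ)
    (hψb : ∀ t, ψ t ∈ Icc (0 : ℝ) 1)
    (hlim : Tendsto (fun t => t ^ (1 - α) * ψ t) atTop (𝓝 ℓ)) :
    Tendsto (fun s => s ^ (1 - α) * conv A ψ s) atTop (𝓝 (ℓ * ∫ v in Ioi (0 : ℝ), A v)) := by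
  have hβ : 0 < 1 - α := sub_pos.2 hα1
  obtain ⟨C, hC0, hC⟩ : ∃ C : ℝ, 0 ≤ C ∧ ∀ t, 0 ≤ t → t ^ (1 - α) * ψ t ≤ C := by
    obtain ⟨T, hT⟩ := eventually_atTop.1 (hlim.eventually (gt_mem_nhds (lt_add_one ℓ)))
    refine ⟨max (|T| ^ (1 - α)) (ℓ + 1), le_max_of_le_left (by positivity), fun t ht => ?_⟩
    rcases le_total T t with h | h
    · exact le_max_of_le_right (hT t h).le
    · refine le_max_of_le_left ?_
      exact (mul_le_of_le_one_right (Real.rpow_nonneg ht _) (hψb t).2).trans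
        (Real.rpow_le_rpow ht (h.trans (le_abs_self T)) hβ.le)
  set F : ℝ → ℝ → ℝ := fun s v => (Ioc 0 s).indicator
    (fun v => A v * (s ^ (1 - α) * ψ (s - v))) v with hF
  have hconv : ∀ s, 0 ≤ s → ∫ v in Ioi (0 : ℝ), F s v = s ^ (1 - α) * conv A ψ s := by
    intro s hs
    simp only [hF]
    rw [setIntegral_indicator measurableSet_Ioc,
      inter_eq_self_of_subset_right Ioc_subset_Ioi_self, ← intervalIntegral.integral_of_le hs]
    have h1 := intervalIntegral.integral_comp_sub_left (a := 0) (b := s)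
      (fun v => A v * (s ^ (1 - α) * ψ (s - v))) s
    rw [sub_self, sub_zero] at h1
    rw [← h1, conv, ← intervalIntegral.integral_const_mul]
    refine intervalIntegral.integral_congr fun u _ => ?_
    simp only [sub_sub_cancel]
    ring
  have hbound : IntegrableOn (fun v : ℝ => Real.exp (-(δ * v)) * C +
      v ^ (1 - α) * Real.exp (-δ * v ^ (1 : ℝ))) (Ioi 0) := by
    refine Integrable.add ?_
      (integrableOn_rpow_mul_exp_neg_mul_rpow (by linarith) zero_lt_one hδ)
    have := exp_neg_integrableOn_Ioi 0 hδ
    simp only [neg_mul] at this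
    exact this.mul_const C
  have hmain : Tendsto (fun s => ∫ v in Ioi (0 : ℝ), F s v) atTop
      (𝓝 (∫ v in Ioi (0 : ℝ), A v * ℓ)) := by
    refine tendsto_integral_filter_of_dominated_convergence _ (Eventually.of_forall fun s => ?_)
      (Eventually.of_forall fun s => ?_) hbound ?_
    · have := hψ.measurable
      exact (Measurable.indicator (by fun_prop) measurableSet_Ioc).aestronglyMeasurable
    · filter_upwards [ae_restrict_mem measurableSet_Ioi] with v hv
      rw [mem_Ioi] at hv
      have hb : 0 ≤ v ^ (1 - α) * Real.exp (-δ * v ^ (1 : ℝ)) :=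
        mul_nonneg (Real.rpow_nonneg hv.le _) (Real.exp_pos _).le
      simp only [hF, indicator_apply]
      split_ifs with h
      · have h0 : 0 ≤ s - v := by linarith [h.2]
        have h1 : s ^ (1 - α) ≤ (s - v) ^ (1 - α) + v ^ (1 - α) := by
          have := Real.rpow_add_le_add_rpow h0 hv.le hβ.le (by linarith : 1 - α ≤ 1)
          rwa [sub_add_cancel] at this
        have h2 : s ^ (1 - α) * ψ (s - v) ≤ C + v ^ (1 - α) := by
          have h3 := hC _ h0
          have h4 := mul_le_mul_of_nonneg_right h1 (hψb (s - v)).1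
          have h5 := mul_le_of_le_one_right (Real.rpow_nonneg hv.le (1 - α)) (hψb (s - v)).2
          linarith
        have h6 : 0 ≤ s ^ (1 - α) * ψ (s - v) :=
          mul_nonneg (Real.rpow_nonneg (hv.le.trans h.2) _) (hψb _).1
        rw [norm_mul, Real.norm_eq_abs, Real.norm_of_nonneg h6, Real.rpow_one]
        refine (mul_le_mul (hAb v hv.le) h2 h6 (Real.exp_pos _).le).trans (le_of_eq ?_)
        ring_nf
      · simp only [norm_zero]
        positivity
    · filter_upwards [ae_restrict_mem measurableSet_Ioi] with v hv
      rw [mem_Ioi] at hv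
      have h1 : Tendsto (fun s : ℝ => s - v) atTop atTop :=
        tendsto_atTop_add_const_right _ _ tendsto_id
      have h2 : Tendsto (fun s : ℝ => s / (s - v)) atTop (𝓝 1) := by
        have h3 : Tendsto (fun s : ℝ => 1 + v / (s - v)) atTop (𝓝 (1 + 0)) :=
          (tendsto_const_nhds.div_atTop h1).const_add 1
        rw [add_zero] at h3
        refine h3.congr' ?_
        filter_upwards [eventually_gt_atTop v] with s hs
        have : s - v ≠ 0 := (sub_pos.2 hs).ne'
        field_simp
        ring
      have h4 : Tendsto (fun s : ℝ => (s / (s - v)) ^ (1 - α)) atTop (𝓝 1) := by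
        simpa using h2.rpow_const (p := 1 - α) (Or.inl one_ne_zero)
      have h5 := (h4.mul (hlim.comp h1)).const_mul (A v)
      rw [one_mul] at h5
      refine h5.congr' ?_
      filter_upwards [eventually_gt_atTop v] with s hs
      have h6 : 0 < s - v := sub_pos.2 hs
      have h7 := (Real.rpow_pos_of_pos h6 (1 - α)).ne'
      simp only [hF, Function.comp]
      rw [indicator_of_mem (show v ∈ Ioc 0 s from ⟨hv, hs.le⟩),
        Real.div_rpow (hv.le.trans hs.le) h6.le]
      field_simp
  rw [integral_mul_const, mul_comm] at hmain
  refine hmain.congr' ?_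
  filter_upwards [eventually_ge_atTop 0] with s hs
  exact hconv s hs

/-- The mean time spent per visit in states with inverse waiting time above `δ`. -/
lemma integral_meanTail (hα : 0 < α) {δ : ℝ} (hδ : 0 < δ) (hδ1 : δ ≤ 1) :
    ∫ t in Ioi (0 : ℝ), meanTail α δ t = α * ∫ x in δ..1, x ^ (α - 2) := by
  have := isProbabilityMeasure_invLaw hα
  have hexp : IntegrableOn (fun t : ℝ => Real.exp (-(δ * t))) (Ioi 0) := by
    have := exp_neg_integrableOn_Ioi 0 hδ
    simpa only [neg_mul] using this
  have hint : Integrable (Function.uncurry fun t x => tailKernel δ t x)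
      ((volume.restrict (Ioi (0 : ℝ))).prod (invLaw α)) := by
    refine Integrable.mono' (hexp.comp_fst (invLaw α)) ?_ ?_
    · refine Measurable.aestronglyMeasurable ?_
      exact Measurable.ite (measurableSet_lt measurable_const measurable_snd) (by fun_prop)
        measurable_const
    · have h1 : ∀ᵐ t ∂volume.restrict (Ioi (0 : ℝ)), (0 : ℝ) < t :=
        ae_restrict_mem measurableSet_Ioi
      have h2 := Measure.quasiMeasurePreserving_fst (μ := volume.restrict (Ioi (0 : ℝ)))
        (ν := invLaw α) |>.ae h1
      filter_upwards [h2] with q hq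
      rw [Function.uncurry_def, Real.norm_of_nonneg (tailKernel_nonneg _ _ _)]
      unfold tailKernel
      split_ifs with h
      · exact Real.exp_le_exp.2 (neg_le_neg (mul_le_mul_of_nonneg_right h.le hq.le))
      · positivity
  have hinner : ∀ x, ∫ t in Ioi (0 : ℝ), tailKernel δ t x = if δ < x then 1 / x else 0 := by
    intro x
    unfold tailKernel
    split_ifs with h
    · have hx : 0 < x := hδ.trans h
      have h1 := integral_exp_mul_Ioi (a := -x) (neg_lt_zero.2 hx) 0
      simp only [neg_mul, mul_zero, Real.exp_zero] at h1
      rw [h1]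
      rw [neg_div_neg_eq]
    · simp
  simp only [meanTail]
  rw [integral_integral_swap hint]
  simp only [hinner]
  rw [integral_invLaw hα, ← intervalIntegral.integral_const_mul,
    intervalIntegral.integral_of_le hδ1, integral_Ioc_eq_integral_Ioo]
  have h1 : ∀ x, α * x ^ (α - 1) * (if δ < x then 1 / x else 0)
      = (Ioi δ).indicator (fun x => α * x ^ (α - 1) * (1 / x)) x := fun x => by
    simp only [indicator_apply, mem_Ioi]; split_ifs <;> simp
  simp_rw [h1]
  rw [setIntegral_indicator measurableSet_Ioi]
  have h2 : Ioo (0 : ℝ) 1 ∩ Ioi δ = Ioo δ 1 := by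
    ext x
    simp only [mem_inter_iff, mem_Ioo, mem_Ioi]
    exact ⟨fun h => ⟨h.2, h.1.2⟩, fun h => ⟨⟨hδ.trans h.1, h.2⟩, h.1⟩⟩
  rw [h2]
  refine setIntegral_congr_fun measurableSet_Ioo fun x hx => ?_
  have hx0 : x ≠ 0 := (hδ.trans hx.1).ne'
  rw [show x ^ (α - 2) = x ^ (α - 1) / x by rw [← Real.rpow_sub_one hx0]; ring_nf]
  ring

end Tail

/-- In a typical landscape the probability of `x > δ` has a limit as the number of sites tends to
infinity, and that limit is asymptotic to `B α δ / c α * s ^ (α - 1)`. -/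
theorem exists_limit_of_isTypical {α : ℝ} (hα0 : 0 < α) (hα1 : α < 1) {e : ℕ → ℝ}
    (hω : IsTypical α (invWait e)) {Ω' : ℕ → Type*} [∀ N, MeasurableSpace (Ω' N)]
    {P : ∀ N, Measure (Ω' N)} {Y : ∀ N, ℝ≥0 → Ω' N → Fin (N + 1)}
    (hY : ∀ N, IsREMTrapWalk e (N + 1) (P N) (Y N)) {δ : ℝ} (hδ : 0 < δ) (hδ1 : δ ≤ 1) :
    ∃ H : ℝ≥0 → ℝ,
      (∀ s : ℝ≥0, 0 < s →
        Tendsto (fun N => (P N).real {w | δ < invWait e (Y N s w)}) atTop (𝓝 (H s))) ∧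
      Tendsto (fun s : ℝ≥0 => (s : ℝ) ^ (1 - α) * H s) atTop (𝓝 (B α δ / c α)) := by
  obtain ⟨ψ, hψ, hψb, hlim⟩ := exists_limit_rate hω fun N => (hY N).isTrapFlow
  have hren : ∀ t, 0 ≤ t → meanTail α 0 t + conv (meanTail α 0) ψ t = 1 := by
    intro t ht
    refine tendsto_nhds_unique (hlim 0 t ht) (tendsto_const_nhds.congr fun N => ?_)
    rw [← (hY N).isTrapFlow.sum_eq_one t]
    exact Finset.sum_congr rfl fun i _ => (if_pos (hω.mem_Ioo i).1).symm
  refine ⟨fun s => meanTail α δ s + conv (meanTail α δ) ψ s, fun s _ => ?_, ?_⟩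
  · refine (hlim δ s s.2).congr fun N => ?_
    have := (hY N).isProbabilityMeasure
    rw [measureReal_eq_sum_inter (P := P N) ((hY N).measurable s)]
    refine Finset.sum_congr rfl fun i _ => ?_
    split_ifs with h
    · rw [occ, Real.toNNReal_coe]
      congr 1
      ext w
      simp only [mem_ofPred_eq]
      exact ⟨fun hw => ⟨hw, by rw [hw]; exact h⟩, fun hw => hw.1⟩
    · symm
      rw [measureReal_eq_zero_iff]
      convert measure_empty (μ := P N)
      ext w
      simp only [mem_ofPred_eq, mem_empty_iff_false, iff_false, not_and]
      intro hw
      rw [hw]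
      exact h
  · have h1 := tendsto_rpow_mul_conv hα0 hα1 hδ (continuous_meanTail hα0 δ).measurable
      (fun t ht => by
        rw [abs_of_nonneg (meanTail_nonneg _ _)]; exact meanTail_le_exp hα0 ht) hψ hψb
      (tendsto_rate hα0 hα1 hψ hψb hren)
    have h2 : Tendsto (fun s : ℝ => s ^ (1 - α) * meanTail α δ s) atTop (𝓝 0) := by
      have h3 := tendsto_rpow_mul_exp_neg_mul_atTop_nhds_zero (1 - α) δ hδ
      refine squeeze_zero' ?_ ?_ h3
      · filter_upwards [eventually_ge_atTop 0] with s hs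
        exact mul_nonneg (Real.rpow_nonneg hs _) (meanTail_nonneg _ _)
      · filter_upwards [eventually_ge_atTop 0] with s hs
        refine mul_le_mul_of_nonneg_left ?_ (Real.rpow_nonneg hs _)
        rw [neg_mul]
        exact meanTail_le_exp hα0 hs
    have h4 := (h2.add h1).comp (NNReal.tendsto_coe_atTop.2 tendsto_id)
    refine (h4.congr fun s => ?_).trans (le_of_eq ?_)
    · simp only [Function.comp, id]
      ring
    · rw [integral_meanTail hα0 hδ hδ1, B, kappa]
      have hc := (c_pos hα0).ne'
      have hI := (integral_div_one_add_pos hα0 hα1).ne'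
      congr 1
      field_simp
      ring

end TrapModel

theorem proposition2p7 {α : ℝ} (hα0 : 0 < α) (hα1 : α < 1)
    {Ω : Type*} [MeasurableSpace Ω] (μ : Measure Ω) [IsProbabilityMeasure μ]
    (E : ℕ → Ω → ℝ) (hindep : iIndepFun E μ) (hlaw : ∀ i, HasLaw (E i) (expMeasure α) μ) :
    ∀ᵐ ω ∂μ,
      ∀ (Ω' : ℕ → Type*) [∀ N, MeasurableSpace (Ω' N)] (P : ∀ N, Measure (Ω' N))
        (Y : ∀ N, ℝ≥0 → Ω' N → Fin (N + 1)),
        (∀ N, TrapModel.IsREMTrapWalk (fun i => E i ω) (N + 1) (P N) (Y N)) →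
      ∀ δ : ℝ, 0 < δ → δ ≤ 1 →
        ∃ H : ℝ≥0 → ℝ,
          (∀ s : ℝ≥0, 0 < s →
            Tendsto (fun N => (P N).real
                {w | δ < TrapModel.invWait (fun i => E i ω) (Y N s w)})
              atTop (𝓝 (H s))) ∧
          Tendsto (fun s : ℝ≥0 => (s : ℝ) ^ (1 - α) * H s) atTop
            (𝓝 (TrapModel.B α δ / TrapModel.c α)) := by
  filter_upwards [TrapModel.ae_isTypical hα0 hindep hlaw] with ω hω
  intro Ω' _ P Y hY δ hδ hδ1
  exact TrapModel.exists_limit_of_isTypical hα0 hα1 hω hY hδ hδ1
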